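/- Let $(\Omega,\mathcal F,P)$ be a complete probability space with an invertible, bi-measurable, $P$-preserving ergodic map $\theta$, and let $(\mathcal X,\rho)$ be a compact metric space with its Borel $\sigma$-algebra. Let $T_\omega:\mathcal X\to\mathcal X$, $\omega\in\Omega$, be continuous surjective maps such that $(\omega,x)\mapsto T_\omega x$ is measurable, and put $T_\omega^n=T_{\theta^{n-1}\omega}\circ\cdots\circ T_\omega$. Let $\xi>0$ and $\alpha\in(0,1]$. For $g:\mathcal X\to\mathbb C$ put $\|g\|_{\alpha,\xi}=\sup|g|+\inf\{R\ge 0:|g(x)-g(x')|\le R\rho(x,x')^\alpha\text{ whenever }\rho(x,x')<\xi\}$, and let $\mathcal H^{\alpha,\xi}$ be the space of functions with $\|g\|_{\alpha,\xi}<\infty$. Assume: (a) there is a $P$-a.s. bounded random variable $n_\omega\in\mathbb N$ such that, $P$-a.s., $T_\omega^{n_\omega}(B(x,\xi))=\mathcal X$ for every $x\in\mathcal X$; (b) there are random variables $\gamma_\omega$ and $D_\omega$, with $D_\omega$ bounded and $\gamma_\omega-1\ge\delta$ for some constant $\delta>0$, such that, $P$-a.s., for all $x,x'$ with $\rho(x,x')<\xi$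 one can enumerate without repetition $T_\omega^{-1}\{x\}=\{y_1,\dots,y_k\}$ and $T_\omega^{-1}\{x'\}=\{y'_1,\dots,y'_k\}$ with $k\le D_\omega$ and $\rho(y_i,y'_i)\le\gamma_\omega^{-1}\rho(x,x')$ for all $i$; (c) $\phi,u:\Omega\times\mathcal X\to\mathbb R$ are measurable, $\|\phi_\omega\|_{\alpha,\xi}$ and $\|u_\omega\|_{\alpha,\xi}$ are $P$-a.s. bounded by constants, and for every $z\in\mathbb C$ the operators $\mathcal L_z^\omega g(x)=\sum_{y\in T_\omega^{-1}\{x\}}e^{\phi_\omega(y)+zu_\omega(y)}g(y)$ are measurable, i.e. $(\omega,x)\mapsto\mathcal L_z^\omega g_\omega(x)$ is measurable for every measurable $g:\Omega\times\mathcal X\to\mathbb C$. Let $(\lambda_\omega,h_\omega,\nu_\omega)$ be a random Ruelle–Perron–Frobenius triplet of $\mathcal L_0^\omega$: depending measurably on $\omega$, with $\nu_\omega$ a probability measure and, $P$-a.s., $\lambda_\omega>0$, $h_\omega\in\mathcal H^{\alpha,\xi}$ strictly positive, $\mathcal L_0^\omega h_\omega=\lambda_\omega h_{\theta\omega}$,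 $\nu_{\theta\omega}(\mathcal L_0^\omega g)=\lambda_\omega\nu_\omega(g)$ for all continuous $g$, and $\nu_\omega(h_\omega)=1$. Let $\mu_\omega=h_\omega\nu_\omega$ be the Gibbs measures. For $\psi:\Omega\times\mathcal X\to\mathbb R$ put $S_n^\omega\psi=\sum_{j=0}^{n-1}\psi_{\theta^j\omega}\circ T_\omega^j$; put $\bar u_\omega=u_\omega-\mu_\omega(u_\omega)$ and $V_n(\omega)=\mathrm{var}_{\mu_\omega}(S_n^\omega u)$. Suppose that there are a measure $\mu$ on $\mathcal X$, constants $0<m<M<\infty$ and measurable functions $r_\omega:\mathcal X\to(m,M)$ with $\mu_\omega=r_\omega\mu$ for $P$-a.e. $\omega$, and put $\tilde V_k(\omega)=\int(S_k^\omega\bar u)^2\,d\mu$. Let $\beta>0$. (1) If there are $d_1>0$ and constants $d_2(k)$ such that for all sufficiently large $k$ and all $n\ge1$ $$P\Big\{\omega:\sum_{j=0}^{n-1}\tilde V_k(\theta^{jk}\omega)\le d_1kn\Big\}\le\frac{d_2(k)}{n^\beta},$$ then there are $c_1,c_2>0$ such that for all $n\ge1$ $$P\{\omega:V_n(\omega)\le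 c_1n\}\le\frac{c_2}{n^\beta}.\qquad(*)$$ (2) If the asymptotic variance is positive, i.e. $\limsup_{n\to\infty}\frac1nV_n(\omega)>0$ for $P$-a.e. $\omega$ (under the above assumptions this upper limit is a.s. a limit and a constant $\sigma^2$), and there are constants $d(k,\varepsilon)$ such that for all sufficiently large $k$, all $\varepsilon>0$ and all $n\ge1$ $$P\Big\{\omega:\Big|\sum_{j=0}^{n-1}\tilde V_k(\theta^{jk}\omega)-n\int\tilde V_k\,dP\Big|\ge\varepsilon n\Big\}\le\frac{d(k,\varepsilon)}{n^\beta},$$ then $(*)$ holds for some $c_1,c_2>0$. -/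

import Mathlib

open MeasureTheory ProbabilityTheory Filter Topology
open scoped ENNReal NNReal

noncomputable section

namespace RandomExpanding

section Holder

variable {X E : Type*} [MetricSpace X] [NormedAddCommGroup E]

/-- `v_{α,ξ}(g)`: the infimum of all `R ≥ 0` such that `|g x - g x'| ≤ R ρ(x,x')^α` whenever
`ρ(x,x') < ξ` (it is `∞` if there is no such `R`). -/
def holderConst (α ξ : ℝ) (g : X → E) : ℝ≥0∞ :=
  ⨅ (R : ℝ≥0) (_ : ∀ x x' : X, dist x x' < ξ → ‖g x - g x'‖ ≤ (R : ℝ) * dist x x' ^ α),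
    (R : ℝ≥0∞)

/-- `‖g‖_{α,ξ} = ‖g‖_∞ + v_{α,ξ}(g)`, where `‖g‖_∞` is the supremum norm. -/
def holderNorm (α ξ : ℝ) (g : X → E) : ℝ≥0∞ :=
  (⨆ x : X, ‖g x‖ₑ) + holderConst α ξ g

/-- Membership in `H^{α,ξ}`. -/
def IsHolder (α ξ : ℝ) (g : X → E) : Prop :=
  holderNorm α ξ g < ∞

end Holder

section Dynamics

variable {Ω X : Type*}

/-- `T_ω^n = T_{θ^{n-1}ω} ∘ ⋯ ∘ T_{θω} ∘ T_ω`. -/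
def fiberIter (θ : Ω → Ω) (T : Ω → X → X) : ℕ → Ω → X → X
  | 0, _, x => x
  | n + 1, ω, x => T (θ^[n] ω) (fiberIter θ T n ω x)

/-- `S_n^ω ψ = ∑_{j<n} ψ_{θ^j ω} ∘ T_ω^j`. -/
def fiberSum (θ : Ω → Ω) (T : Ω → X → X) (ψ : Ω → X → ℝ) (n : ℕ) (ω : Ω) (x : X) : ℝ :=
  ∑ j ∈ Finset.range n, ψ (θ^[j] ω) (fiberIter θ T j ω x)

/-- The transfer operator of a map `τ` with weight `w`: `g ↦ (x ↦ ∑_{y ∈ τ⁻¹{x}} w(y) g(y))`. -/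
def weightedTransfer {K : Type*} [Semiring K] (τ : X → X) (w g : X → K) (x : X) : K :=
  ∑ᶠ y ∈ τ ⁻¹' {x}, w y * g y

/-- `L_z^ω g (x) = ∑_{y ∈ T_ω⁻¹{x}} exp(φ_ω(y) + z u_ω(y)) g(y)`. -/
def transferOp (T : Ω → X → X) (φ u : Ω → X → ℝ) (z : ℂ) (ω : Ω) (g : X → ℂ) : X → ℂ :=
  weightedTransfer (T ω) (fun y => Complex.exp ((φ ω y : ℂ) + z * (u ω y : ℂ))) g

/-- The operator `L_0^ω` acting on real functions. -/
def transferOpZero (T : Ω → X → X) (φ : Ω → X → ℝ) (ω : Ω) (g : X → ℝ) : X → ℝ :=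
  weightedTransfer (T ω) (fun y => Real.exp (φ ω y)) g

end Dynamics

section Assumptions

variable {Ω X : Type*} [MeasurableSpace Ω] [MetricSpace X]

/-- Topological exactness at scale `ξ`, with covering time `N_ω`. -/
def TopologicallyExact (P : Measure Ω) (θ : Ω → Ω) (T : Ω → X → X) (ξ : ℝ) (N : Ω → ℕ) : Prop :=
  ∀ᵐ ω ∂P, ∀ x : X, fiberIter θ T (N ω) ω '' Metric.ball x ξ = Set.univ

/-- The pairing property at scale `ξ`: the preimages of two `ξ`-close points can be enumerated
(without repetition) in such a way that `T_ω⁻¹` contracts distances by the factor `γ_ω⁻¹`,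
and their number is at most `D_ω`. -/
def PairingProperty (P : Measure Ω) (T : Ω → X → X) (ξ : ℝ) (γ D : Ω → ℝ) : Prop :=
  ∀ᵐ ω ∂P, 1 < γ ω ∧ ∀ x x' : X, dist x x' < ξ →
    ∃ (k : ℕ) (y y' : Fin k → X),
      Function.Injective y ∧ Function.Injective y' ∧
      T ω ⁻¹' {x} = Set.range y ∧ T ω ⁻¹' {x'} = Set.range y' ∧
      (k : ℝ) ≤ D ω ∧ ∀ i, dist (y i) (y' i) ≤ (γ ω)⁻¹ * dist x x'

variable [MeasurableSpace X]

/-- The standing assumptions on the fiber maps `T_ω`, the potential `φ` and the observable `u`. -/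
structure StandingAssumptions (P : Measure Ω) (θ : Ω → Ω) (T : Ω → X → X) (φ u : Ω → X → ℝ)
    (α ξ : ℝ) : Prop where
  alpha_pos : 0 < α
  alpha_le_one : α ≤ 1
  xi_pos : 0 < ξ
  continuous_map : ∀ ω, Continuous (T ω)
  surjective_map : ∀ ω, Function.Surjective (T ω)
  measurable_map : Measurable (fun p : Ω × X => T p.1 p.2)
  measurable_potential : Measurable (fun p : Ω × X => φ p.1 p.2)
  measurable_observable : Measurable (fun p : Ω × X => u p.1 p.2)
  /-- topological exactness, with a bounded covering time -/
  exact : ∃ N : Ω → ℕ, Measurable N ∧ TopologicallyExact P θ T ξ N ∧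
    ∃ N₀ : ℕ, ∀ᵐ ω ∂P, N ω ≤ N₀
  /-- pairing property, with bounded `D_ω` and with `γ_ω - 1` bounded away from `0` -/
  pairing : ∃ γ D : Ω → ℝ, Measurable γ ∧ Measurable D ∧ PairingProperty P T ξ γ D ∧
    (∃ D₀ : ℝ, ∀ᵐ ω ∂P, D ω ≤ D₀) ∧ (∃ δ : ℝ, 0 < δ ∧ ∀ᵐ ω ∂P, δ ≤ γ ω - 1)
  potential_bounded : ∃ C : ℝ≥0, ∀ᵐ ω ∂P, holderNorm α ξ (φ ω) ≤ C
  observable_bounded : ∃ C : ℝ≥0, ∀ᵐ ω ∂P, holderNorm α ξ (u ω) ≤ C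
  transfer_measurable : ∀ (z : ℂ) (g : Ω → X → ℂ), Measurable (fun p : Ω × X => g p.1 p.2) →
    Measurable (fun p : Ω × X => transferOp T φ u z p.1 (g p.1) p.2)

/-- `(λ, h, ν)` is a random Ruelle-Perron-Frobenius triplet of the family `L_0^ω`: `λ_ω > 0`,
`h_ω ∈ H^{α,ξ}` is strictly positive, `ν_ω` is a probability measure, all depend measurably on
`ω`, and `P`-a.s. `L_0^ω h_ω = λ_ω h_{θω}`, `(L_0^ω)^* ν_{θω} = λ_ω ν_ω`, `ν_ω(h_ω) = 1`. -/
structure IsRPFTriplet (P : Measure Ω) (θ : Ω → Ω) (T : Ω → X → X) (φ : Ω → X → ℝ) (α ξ : ℝ)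
    (lam : Ω → ℝ) (h : Ω → X → ℝ) (ν : Kernel Ω X) : Prop where
  measurable_eigenvalue : Measurable lam
  measurable_eigenfunction : Measurable (fun p : Ω × X => h p.1 p.2)
  isMarkov : IsMarkovKernel ν
  eigenvalue_pos : ∀ᵐ ω ∂P, 0 < lam ω
  eigenfunction_pos : ∀ᵐ ω ∂P, ∀ x, 0 < h ω x
  eigenfunction_holder : ∀ᵐ ω ∂P, IsHolder α ξ (h ω)
  eigenfunction_eq : ∀ᵐ ω ∂P, ∀ x, transferOpZero T φ ω (h ω) x = lam ω * h (θ ω) x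
  conformal : ∀ᵐ ω ∂P, ∀ g : X → ℝ, Continuous g →
    ∫ x, transferOpZero T φ ω g x ∂(ν (θ ω)) = lam ω * ∫ x, g x ∂(ν ω)
  normalized : ∀ᵐ ω ∂P, ∫ x, h ω x ∂(ν ω) = 1

/-- The Gibbs measures `μ_ω = h_ω ν_ω`. -/
def gibbs (h : Ω → X → ℝ) (ν : Kernel Ω X) (ω : Ω) : Measure X :=
  (ν ω).withDensity (fun x => ENNReal.ofReal (h ω x))

end Assumptions

section Variances

variable {Ω X : Type*} [MeasurableSpace X]

/-- `ū_ω = u_ω - μ_ω(u_ω)`. -/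
def centered (μ : Ω → Measure X) (u : Ω → X → ℝ) (ω : Ω) (x : X) : ℝ :=
  u ω x - ∫ y, u ω y ∂(μ ω)

/-- `V_n(ω) = var_{μ_ω}(S_n^ω u)`. -/
def fiberVariance (θ : Ω → Ω) (T : Ω → X → X) (u : Ω → X → ℝ) (μ : Ω → Measure X)
    (n : ℕ) (ω : Ω) : ℝ :=
  variance (fiberSum θ T u n ω) (μ ω)

/-- `Ṽ_k(ω) = ∫ (S_k^ω ū)² dκ` for a reference measure `κ`. -/
def blockVariance (θ : Ω → Ω) (T : Ω → X → X) (u : Ω → X → ℝ) (μ : Ω → Measure X)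
    (κ : Measure X) (k : ℕ) (ω : Ω) : ℝ :=
  ∫ x, (fiberSum θ T (centered μ u) k ω x) ^ 2 ∂κ

/-- The asymptotic variance `σ²(ω)` of `V_n(ω)/n`. It is taken as an upper limit, so that no
convergence has to be presupposed; it is the limit whenever that exists. -/
def asymptoticVariance (V : ℕ → Ω → ℝ) (ω : Ω) : ℝ≥0∞ :=
  limsup (fun n : ℕ => ENNReal.ofReal (V n ω / n)) atTop

variable [MeasurableSpace Ω]

/-- Variance growth: for some `c₁, c₂ > 0`, `P{V_n ≤ c₁ n} ≤ c₂ / n^β` for all `n ≥ 1`. -/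
def VarianceGrowth (P : Measure Ω) (V : ℕ → Ω → ℝ) (β : ℝ) : Prop :=
  ∃ c₁ c₂ : ℝ, 0 < c₁ ∧ 0 < c₂ ∧ ∀ n : ℕ, 1 ≤ n →
    P.real {ω | V n ω ≤ c₁ * n} ≤ c₂ / (n : ℝ) ^ β

/-- Lower deviation bound for block variances: there are `d₁ > 0` and constants `d₂(k)` with
`P{∑_{j<n} W_k(θ^{jk} ω) ≤ d₁ k n} ≤ d₂(k) / n^β` for all sufficiently large `k` and all
`n ≥ 1`. -/
def BlockLowerDeviation (P : Measure Ω) (θ : Ω → Ω) (W : ℕ → Ω → ℝ) (β : ℝ) : Prop :=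
  ∃ (d₁ : ℝ) (d₂ : ℕ → ℝ), 0 < d₁ ∧ ∀ᶠ k : ℕ in atTop, ∀ n : ℕ, 1 ≤ n →
    P.real {ω | ∑ j ∈ Finset.range n, W k (θ^[j * k] ω) ≤ d₁ * k * n} ≤ d₂ k / (n : ℝ) ^ β

/-- Polynomial concentration of block variances: there are constants `d(k,ε)` with
`P{|∑_{j<n} W_k(θ^{jk} ω) - n E_P W_k| ≥ ε n} ≤ d(k,ε) / n^β` for all sufficiently large `k`,
all `ε > 0` and all `n ≥ 1`. -/
def BlockConcentration (P : Measure Ω) (θ : Ω → Ω) (W : ℕ → Ω → ℝ) (β : ℝ) : Prop :=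
  ∃ d : ℕ → ℝ → ℝ, ∀ᶠ k : ℕ in atTop, ∀ ε : ℝ, 0 < ε → ∀ n : ℕ, 1 ≤ n →
    P.real {ω | ε * n ≤ |∑ j ∈ Finset.range n, W k (θ^[j * k] ω) - n * ∫ ω', W k ω' ∂P|}
      ≤ d k ε / (n : ℝ) ^ β

end Variances

end RandomExpanding

end

/-! The engine is a quasi-additivity of the fiber variances: for almost every `ω`, `V_{a+b}(ω)`
equals `V_a(ω) + V_b(θ^a ω)` up to an error `C` that depends on neither `ω`, `a` nor `b`
(`DualContraction.exists_quasi_additive`). Cutting `n` into blocks of length `k` therefore costs `C`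
per block, which is negligible against the linear lower bound `d₁ k` per block once `k` is large.
Since `V_k ≥ m Ṽ_k`, a lower deviation bound for the block sums of `Ṽ_k` passes to `V_n`; this is
`BlockLowerDeviation.varianceGrowth` and gives (1).

For (2) it remains to see that the mean of `Ṽ_k` grows linearly. By `Ṽ_k ≥ V_k / M` it suffices to
treat `V_k`. On a set of positive probability `V_n` exceeds a fixed multiple of `n` infinitely
often, so by quasi-additivity some Birkhoff sum of `V_k - (ε k - C)` under `θ^k` is positive there;
the maximal ergodic inequality turns this into a lower bound for the mean
(`exists_linear_growth_integral`). Concentration around a linearly growing mean is then a lower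
deviation bound, and (1) applies.

The error in quasi-additivity is twice a cross term, a double sum of correlations. It is bounded
because correlations decay exponentially, uniformly in `ω`. Decay is proved for the transfer
operator normalized by `h` and `λ`, which fixes constants. It contracts logarithmic Hölder
constants, and after the covering time it dominates a fixed fraction of the maximum; peeling off
part of this fraction repeatedly makes the oscillation decay geometrically
(`exists_oscillation_decay`).

Uniform constants for `h` are not assumed and have to be derived:
`exists_ae_logHolder_of_eigenfunction` bounds the logarithmic Hölder constant by invariance of `P`,
and `eigenfunction_ratio_le` bounds `sup h / inf h`. -/

namespace RandomExpanding

/-! ### Positive functions with locally Hölder logarithm -/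

section LogHolder

variable {X : Type*} [MetricSpace X]

/-- `g` is positive and `log g` is locally `α`-Hölder at scale `ξ` with constant `Q`. -/
structure LogHolder (α ξ Q : ℝ) (g : X → ℝ) : Prop where
  pos : ∀ x, 0 < g x
  le : ∀ x x', dist x x' < ξ → g x ≤ Real.exp (Q * dist x x' ^ α) * g x'

theorem continuous_of_locally_holder {α ξ R : ℝ} (hα : 0 < α) (hξ : 0 < ξ) {g : X → ℝ}
    (hg : ∀ x x', dist x x' < ξ → |g x - g x'| ≤ R * dist x x' ^ α) : Continuous g := by
  rw [continuous_iff_continuousAt]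
  intro x
  rw [ContinuousAt, tendsto_iff_dist_tendsto_zero]
  have hlim : Tendsto (fun y => R * dist y x ^ α) (𝓝 x) (𝓝 0) := by
    have h1 : Tendsto (fun y => dist y x) (𝓝 x) (𝓝 0) := by
      have := (continuous_id.dist (continuous_const (y := x))).tendsto x
      simpa using this
    have h2 := (h1.rpow_const (p := α) (Or.inr hα.le)).const_mul R
    simpa [Real.zero_rpow hα.ne'] using h2
  refine squeeze_zero' (Eventually.of_forall fun _ => dist_nonneg) ?_ hlim
  filter_upwards [Metric.ball_mem_nhds x hξ] with y hy
  rw [Real.dist_eq]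
  exact hg y x hy

/-- Strictness lets an admissible Hölder constant below `C` be chosen without knowing that the
infimum is attained. -/
theorem exists_bound_of_holderNorm_lt {E : Type*} [NormedAddCommGroup E] {α ξ : ℝ} {C : ℝ≥0}
    {g : X → E} (hg : holderNorm α ξ g < C) :
    (∀ x, ‖g x‖ ≤ C) ∧ ∀ x x', dist x x' < ξ → ‖g x - g x'‖ ≤ C * dist x x' ^ α := by
  unfold holderNorm at hg
  constructor
  · intro x
    have h1 : ‖g x‖ₑ ≤ C := ((le_iSup (fun x => ‖g x‖ₑ) x).trans le_self_add).trans hg.le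
    rw [← ofReal_norm] at h1
    exact (ENNReal.ofReal_le_coe).1 h1
  · have h2 : holderConst α ξ g < C := lt_of_le_of_lt le_add_self hg
    unfold holderConst at h2
    simp only [iInf_lt_iff] at h2
    obtain ⟨R, hR, hRC⟩ := h2
    intro x x' hx
    refine (hR x x' hx).trans (mul_le_mul_of_nonneg_right ?_ (by positivity))
    exact_mod_cast (ENNReal.coe_lt_coe.1 hRC).le

namespace LogHolder

variable {α ξ Q Q' : ℝ} {f g : X → ℝ}

theorem mono (hg : LogHolder α ξ Q g) (h : Q ≤ Q') : LogHolder α ξ Q' g where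
  pos := hg.pos
  le x x' hx := (hg.le x x' hx).trans <| mul_le_mul_of_nonneg_right
    (Real.exp_le_exp.2 (mul_le_mul_of_nonneg_right h (by positivity))) (hg.pos x').le

theorem continuous (hg : LogHolder α ξ Q g) (hα : 0 < α) (hξ : 0 < ξ) : Continuous g := by
  have h1 : ∀ x x', dist x x' < ξ → Real.log (g x) - Real.log (g x') ≤ Q * dist x x' ^ α := by
    intro x x' hx
    have h2 := Real.log_le_log (hg.pos x) (hg.le x x' hx)
    rw [Real.log_mul (Real.exp_ne_zero _) (hg.pos x').ne', Real.log_exp] at h2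
    linarith
  have h3 : Continuous fun x => Real.log (g x) := by
    refine continuous_of_locally_holder (R := Q) hα hξ fun x x' hx => abs_le.2 ⟨?_, h1 x x' hx⟩
    have := h1 x' x (by rwa [dist_comm])
    rw [dist_comm] at this
    linarith
  have h4 : g = fun x => Real.exp (Real.log (g x)) := by
    funext x; rw [Real.exp_log (hg.pos x)]
  rw [h4]
  exact Real.continuous_exp.comp h3

theorem mul (hf : LogHolder α ξ Q f) (hg : LogHolder α ξ Q' g) :
    LogHolder α ξ (Q + Q') (fun x => f x * g x) where
  pos x := mul_pos (hf.pos x) (hg.pos x)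
  le x x' hx := by
    have := mul_le_mul (hf.le x x' hx) (hg.le x x' hx) (hg.pos x).le
      (mul_nonneg (Real.exp_pos _).le (hf.pos x').le)
    refine this.trans_eq ?_
    rw [add_mul, Real.exp_add]
    ring

theorem inv (hf : LogHolder α ξ Q f) : LogHolder α ξ Q (fun x => (f x)⁻¹) where
  pos x := inv_pos.2 (hf.pos x)
  le x x' hx := by
    have h1 := hf.le x' x (by rwa [dist_comm])
    rw [dist_comm] at h1
    have h2 := hf.pos x
    have h3 := hf.pos x'
    rw [← div_eq_mul_inv, le_div_iff₀ h3, ← div_eq_inv_mul, div_le_iff₀ h2]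
    exact h1

theorem const_mul (hf : LogHolder α ξ Q f) {c : ℝ} (hc : 0 < c) :
    LogHolder α ξ Q (fun x => c * f x) where
  pos x := mul_pos hc (hf.pos x)
  le x x' hx := by
    have := mul_le_mul_of_nonneg_left (hf.le x x' hx) hc.le
    linarith

theorem exp_comp {R : ℝ} {φ : X → ℝ}
    (hφ : ∀ x x', dist x x' < ξ → |φ x - φ x'| ≤ R * dist x x' ^ α) :
    LogHolder α ξ R (fun x => Real.exp (φ x)) where
  pos x := Real.exp_pos _
  le x x' hx := by
    rw [← Real.exp_add, Real.exp_le_exp]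
    have := (abs_le.1 (hφ x x' hx)).2
    linarith

/-- Where `g ≥ m`, the additive error `R ρ^α` is at most the relative error `(R / m) ρ^α g`, and `1
+ t ≤ exp t`. -/
theorem of_lower_bound {R m : ℝ} (hm : 0 < m) (hR : 0 ≤ R) (hgm : ∀ x, m ≤ g x)
    (hg : ∀ x x', dist x x' < ξ → |g x - g x'| ≤ R * dist x x' ^ α) :
    LogHolder α ξ (R / m) g where
  pos x := hm.trans_le (hgm x)
  le x x' hx := by
    have h1 := (abs_le.1 (hg x x' hx)).2
    have h2 := hgm x'
    have h3 : R * dist x x' ^ α ≤ R / m * dist x x' ^ α * g x' := by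
      have : 0 ≤ R / m * dist x x' ^ α := by positivity
      calc R * dist x x' ^ α = R / m * dist x x' ^ α * m := by field_simp
        _ ≤ _ := mul_le_mul_of_nonneg_left h2 this
    have h4 := Real.add_one_le_exp (R / m * dist x x' ^ α)
    have h5 := mul_le_mul_of_nonneg_right h4 (hm.le.trans h2)
    linarith

/-- Subtracting a constant that is at most the fraction `η` of `g` enlarges the logarithmic
Hölder constant at most by the factor `(1 - η)⁻¹`. -/
theorem sub_const (hg : LogHolder α ξ Q g) (hQ : 0 ≤ Q) {a η : ℝ} (hη0 : 0 ≤ η) (hη : η < 1)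
    (ha : ∀ x, a ≤ η * g x) : LogHolder α ξ (Q / (1 - η)) (fun x => g x - a) where
  pos x := by
    have := hg.pos x
    have := ha x
    nlinarith
  le x x' hx := by
    have hp := hg.pos x'
    have h1 := ha x'
    have h2 := hg.le x x' hx
    set q := Q * dist x x' ^ α with hq
    have hq0 : 0 ≤ q := by positivity
    have hs : 0 < 1 - η := by linarith
    have hs1 : 1 ≤ 1 / (1 - η) := by rw [le_div_iff₀ hs]; linarith
    have hE : 0 ≤ Real.exp q - 1 := by linarith [Real.add_one_le_exp q]
    -- Relative to `g x' - a ≥ (1 - η) g x'`, the increment `exp q - 1` grows by the factor `1 / (1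
    -- - η)`; Bernoulli's inequality moves this factor into the exponent.
    have hbern := one_add_mul_self_le_rpow_one_add (s := Real.exp q - 1) (by linarith) hs1
    have h6 : (1 + (Real.exp q - 1)) ^ (1 / (1 - η)) = Real.exp (Q / (1 - η) * dist x x' ^ α) := by
      rw [add_sub_cancel, ← Real.exp_mul]
      congr 1
      rw [hq]; ring
    rw [h6] at hbern
    have h7 : (1 - η) * g x' ≤ g x' - a := by linarith
    have h8 : (Real.exp q - 1) * g x' ≤ 1 / (1 - η) * (Real.exp q - 1) * (g x' - a) := by
      calc (Real.exp q - 1) * g x' = 1 / (1 - η) * (Real.exp q - 1) * ((1 - η) * g x') := by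
            field_simp
        _ ≤ _ := mul_le_mul_of_nonneg_left h7 (by positivity)
    have h9 : 0 ≤ g x' - a := le_trans (by positivity) h7
    have h10 := mul_le_mul_of_nonneg_right hbern h9
    nlinarith

end LogHolder

end LogHolder

/-! ### Weighted transfer operators of a single map -/

section Transfer

variable {X : Type*} [MetricSpace X]

/-- The preimages under `τ` of two `ξ`-close points can be paired, with contraction `c`, and
their number is at most `D`. -/
def PairedPreimages (ξ c D : ℝ) (τ : X → X) : Prop :=
  ∀ x x' : X, dist x x' < ξ →
    ∃ (k : ℕ) (y y' : Fin k → X),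
      Function.Injective y ∧ Function.Injective y' ∧
      τ ⁻¹' {x} = Set.range y ∧ τ ⁻¹' {x'} = Set.range y' ∧
      (k : ℝ) ≤ D ∧ ∀ i, dist (y i) (y' i) ≤ c * dist x x'

namespace PairedPreimages

variable {α ξ c D : ℝ} {τ : X → X}

theorem exists_enum (hτ : PairedPreimages ξ c D τ) (hξ : 0 < ξ) (x : X) :
    ∃ (k : ℕ) (y : Fin k → X), Function.Injective y ∧ τ ⁻¹' {x} = Set.range y ∧ (k : ℝ) ≤ D := by
  obtain ⟨k, y, _, hy, _, hxy, _, hk, _⟩ := hτ x x (by simpa using hξ)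
  exact ⟨k, y, hy, hxy, hk⟩

theorem weightedTransfer_eq_sum {X : Type*} {τ : X → X} {k : ℕ} {y : Fin k → X} (hy : Function.Injective y) {x : X}
    (hxy : τ ⁻¹' {x} = Set.range y) (w g : X → ℝ) :
    weightedTransfer τ w g x = ∑ i, w (y i) * g (y i) := by
  unfold weightedTransfer
  rw [hxy, finsum_mem_range hy, finsum_eq_sum_of_fintype]

theorem weightedTransfer_sub_mul (hτ : PairedPreimages ξ c D τ) (hξ : 0 < ξ) (w g g' : X → ℝ)
    (a : ℝ) (x : X) : weightedTransfer τ w (fun y => g y - a * g' y) x =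
      weightedTransfer τ w g x - a * weightedTransfer τ w g' x := by
  obtain ⟨k, y, hy, hxy, _⟩ := hτ.exists_enum hξ x
  simp only [weightedTransfer_eq_sum hy hxy, Finset.mul_sum, ← Finset.sum_sub_distrib]
  exact Finset.sum_congr rfl fun i _ => by ring

theorem weightedTransfer_nonneg (hτ : PairedPreimages ξ c D τ) (hξ : 0 < ξ) {w g : X → ℝ}
    (hw : ∀ x, 0 ≤ w x) (hg : ∀ x, 0 ≤ g x) (x : X) : 0 ≤ weightedTransfer τ w g x := by
  obtain ⟨k, y, hy, hxy, _⟩ := hτ.exists_enum hξ x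
  rw [weightedTransfer_eq_sum hy hxy]
  exact Finset.sum_nonneg fun i _ => mul_nonneg (hw _) (hg _)

theorem le_weightedTransfer (hτ : PairedPreimages ξ c D τ) (hξ : 0 < ξ) {w g : X → ℝ}
    (hw : ∀ x, 0 ≤ w x) (hg : ∀ x, 0 ≤ g x) (z : X) : w z * g z ≤ weightedTransfer τ w g (τ z) := by
  obtain ⟨k, y, hy, hxy, _⟩ := hτ.exists_enum hξ (τ z)
  rw [weightedTransfer_eq_sum hy hxy]
  obtain ⟨i, rfl⟩ : z ∈ Set.range y := by rw [← hxy]; simp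
  exact Finset.single_le_sum (f := fun i => w (y i) * g (y i))
    (fun i _ => mul_nonneg (hw _) (hg _)) (Finset.mem_univ i)

theorem weightedTransfer_le (hτ : PairedPreimages ξ c D τ) (hξ : 0 < ξ) {w g : X → ℝ} {W G : ℝ}
    (hw0 : ∀ x, 0 ≤ w x) (hG : 0 ≤ G) (hw : ∀ x, w x ≤ W) (hg : ∀ x, g x ≤ G) (x : X) :
    weightedTransfer τ w g x ≤ D * (W * G) := by
  obtain ⟨k, y, hy, hxy, hk⟩ := hτ.exists_enum hξ x
  rw [weightedTransfer_eq_sum hy hxy]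
  have hW : 0 ≤ W := (hw0 x).trans (hw x)
  calc ∑ i, w (y i) * g (y i) ≤ ∑ _i : Fin k, W * G := by
        refine Finset.sum_le_sum fun i _ => ?_
        exact (mul_le_mul_of_nonneg_left (hg _) (hw0 _)).trans
          (mul_le_mul_of_nonneg_right (hw _) hG)
    _ = k * (W * G) := by simp
    _ ≤ D * (W * G) := mul_le_mul_of_nonneg_right hk (mul_nonneg hW hG)

theorem weightedTransfer_mul_comp (hτ : PairedPreimages ξ c D τ) (hξ : 0 < ξ) (w g f : X → ℝ)
    (x : X) : weightedTransfer τ w (fun y => g y * f (τ y)) x = weightedTransfer τ w g x * f x := by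
  obtain ⟨k, y, hy, hxy, _⟩ := hτ.exists_enum hξ x
  rw [weightedTransfer_eq_sum hy hxy, weightedTransfer_eq_sum hy hxy, Finset.sum_mul]
  refine Finset.sum_congr rfl fun i _ => ?_
  have : τ (y i) = x := by
    have : y i ∈ τ ⁻¹' {x} := by rw [hxy]; exact Set.mem_range_self i
    simpa using this
  rw [this]; ring

/-- The two sums are compared term by term along the pairing of preimages; each pair is closer by
the factor `c`, which gains `c ^ α` in the exponent. -/
theorem logHolder_weightedTransfer (hτ : PairedPreimages ξ c D τ) (hξ : 0 < ξ) (hα : 0 < α)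
    (hc0 : 0 ≤ c) (hc1 : c ≤ 1) (hsurj : Function.Surjective τ) {w g : X → ℝ} {H Q : ℝ}
    (hHQ : 0 ≤ H + Q) (hw : LogHolder α ξ H w) (hg : LogHolder α ξ Q g) :
    LogHolder α ξ (c ^ α * (H + Q)) (weightedTransfer τ w g) where
  pos x := by
    obtain ⟨z, rfl⟩ := hsurj x
    exact (mul_pos (hw.pos z) (hg.pos z)).trans_le
      (hτ.le_weightedTransfer hξ (fun x => (hw.pos x).le) (fun x => (hg.pos x).le) z)
  le x x' hx := by
    obtain ⟨k, y, y', hy, hy', hxy, hxy', _, hd⟩ := hτ x x' hx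
    rw [weightedTransfer_eq_sum hy hxy, weightedTransfer_eq_sum hy' hxy', Finset.mul_sum]
    refine Finset.sum_le_sum fun i _ => ?_
    have hlt : dist (y i) (y' i) < ξ :=
      lt_of_le_of_lt ((hd i).trans (mul_le_of_le_one_left dist_nonneg hc1)) hx
    refine ((hw.mul hg).le _ _ hlt).trans ?_
    refine mul_le_mul_of_nonneg_right (Real.exp_le_exp.2 ?_) ((hw.mul hg).pos _).le
    have h1 : dist (y i) (y' i) ^ α ≤ c ^ α * dist x x' ^ α := by
      rw [← Real.mul_rpow hc0 dist_nonneg]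
      exact Real.rpow_le_rpow dist_nonneg (hd i) hα.le
    calc (H + Q) * dist (y i) (y' i) ^ α ≤ (H + Q) * (c ^ α * dist x x' ^ α) :=
          mul_le_mul_of_nonneg_left h1 hHQ
      _ = _ := by ring

end PairedPreimages

end Transfer

/-! ### Oscillation decay for normalized positive operators -/

section Contraction

variable {Ω X : Type*}

theorem fiberIter_add (θ : Ω → Ω) (T : Ω → X → X) (a b : ℕ) (ω : Ω) (x : X) :
    fiberIter θ T (a + b) ω x = fiberIter θ T b (θ^[a] ω) (fiberIter θ T a ω x) := by
  induction b with
  | zero => rfl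
  | succ b ih =>
    rw [← add_assoc, fiberIter, fiberIter, ih, ← Function.iterate_add_apply, add_comm b a]

/-- `A_{θ^{n-1}ω} ∘ ⋯ ∘ A_ω` for a family of operators `A_ω` acting on functions. -/
def opIter (θ : Ω → Ω) (A : Ω → (X → ℝ) → X → ℝ) : ℕ → Ω → (X → ℝ) → X → ℝ
  | 0, _, g => g
  | n + 1, ω, g => A (θ^[n] ω) (opIter θ A n ω g)

theorem opIter_add (θ : Ω → Ω) (A : Ω → (X → ℝ) → X → ℝ) (a b : ℕ) (ω : Ω) (g : X → ℝ) :
    opIter θ A (a + b) ω g = opIter θ A b (θ^[a] ω) (opIter θ A a ω g) := by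
  induction b with
  | zero => rfl
  | succ b ih =>
    rw [← add_assoc, opIter, opIter, ih, ← Function.iterate_add_apply, add_comm b a]

variable [MetricSpace X]

/-- A family of positive operators `A_ω` with `A_ω 1 = 1` over the fiber maps `T_ω`, which
contract logarithmic Hölder constants and give weight at least `p` to each preimage, uniformly
over a forward invariant set of parameters `ω`. -/
structure UniformlyContracting (θ : Ω → Ω) (T : Ω → X → X) (A : Ω → (X → ℝ) → X → ℝ)
    (good : Set Ω) (α ξ s B p : ℝ) (N : ℕ) : Prop where
  alpha_pos : 0 < α
  xi_pos : 0 < ξ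
  s_nonneg : 0 ≤ s
  s_lt_one : s < 1
  B_nonneg : 0 ≤ B
  p_pos : 0 < p
  p_le_one : p ≤ 1
  N_pos : 0 < N
  shift : ∀ ω ∈ good, θ ω ∈ good
  const : ∀ ω ∈ good, ∀ (a : ℝ) (x : X), A ω (fun _ => a) x = a
  mono : ∀ ω ∈ good, ∀ g g' : X → ℝ, (∀ y, g y ≤ g' y) → ∀ x, A ω g x ≤ A ω g' x
  sub_const : ∀ ω ∈ good, ∀ (g : X → ℝ) (a : ℝ) (x : X), A ω (fun y => g y - a) x = A ω g x - a
  lower : ∀ ω ∈ good, ∀ g : X → ℝ, (∀ y, 0 ≤ g y) → ∀ y, p * g y ≤ A ω g (T ω y)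
  logHolder : ∀ ω ∈ good, ∀ (Q : ℝ) (g : X → ℝ), 0 ≤ Q → LogHolder α ξ Q g →
    LogHolder α ξ (s * (Q + B)) (A ω g)
  exact : ∀ ω ∈ good, ∀ x₀ x : X, ∃ y, dist x₀ y < ξ ∧ fiberIter θ T N ω y = x

namespace UniformlyContracting

variable {θ : Ω → Ω} {T : Ω → X → X} {A : Ω → (X → ℝ) → X → ℝ} {good : Set Ω} {α ξ s B p : ℝ}
  {N : ℕ}

theorem shift_iterate (hA : UniformlyContracting θ T A good α ξ s B p N) {ω : Ω} (hω : ω ∈ good)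
    (n : ℕ) : θ^[n] ω ∈ good := by
  induction n with
  | zero => exact hω
  | succ n ih => rw [Function.iterate_succ_apply']; exact hA.shift _ ih

theorem opIter_sub_const (hA : UniformlyContracting θ T A good α ξ s B p N) {ω : Ω}
    (hω : ω ∈ good) (g : X → ℝ) (a : ℝ) (n : ℕ) :
    opIter θ A n ω (fun y => g y - a) = fun x => opIter θ A n ω g x - a := by
  induction n with
  | zero => rfl
  | succ n ih =>
    funext x
    rw [opIter, ih, hA.sub_const _ (hA.shift_iterate hω n), opIter]

theorem opIter_mem_Icc (hA : UniformlyContracting θ T A good α ξ s B p N) {ω : Ω}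
    (hω : ω ∈ good) {g : X → ℝ} {a b : ℝ} (hg : ∀ x, g x ∈ Set.Icc a b) (n : ℕ) (x : X) :
    opIter θ A n ω g x ∈ Set.Icc a b := by
  induction n generalizing x with
  | zero => exact hg x
  | succ n ih =>
    have hg' := hA.shift_iterate hω n
    constructor
    · rw [← hA.const _ hg' a x, opIter]
      exact hA.mono _ hg' _ _ (fun y => (ih y).1) x
    · rw [← hA.const _ hg' b x, opIter]
      exact hA.mono _ hg' _ _ (fun y => (ih y).2) x

theorem opIter_lower (hA : UniformlyContracting θ T A good α ξ s B p N) {ω : Ω}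
    (hω : ω ∈ good) {g : X → ℝ} (hg : ∀ y, 0 ≤ g y) (n : ℕ) (y : X) :
    p ^ n * g y ≤ opIter θ A n ω g (fiberIter θ T n ω y) := by
  induction n with
  | zero => simp [opIter, fiberIter]
  | succ n ih =>
    have hpos : ∀ x, 0 ≤ opIter θ A n ω g x := by
      clear ih
      induction n with
      | zero => exact hg
      | succ n ih =>
        intro x
        have hg' := hA.shift_iterate hω n
        rw [← hA.const _ hg' 0 x, opIter]
        exact hA.mono _ hg' _ _ ih x
    have h1 := hA.lower _ (hA.shift_iterate hω n) _ hpos (fiberIter θ T n ω y)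
    calc p ^ (n + 1) * g y = p * (p ^ n * g y) := by ring
      _ ≤ p * opIter θ A n ω g (fiberIter θ T n ω y) := mul_le_mul_of_nonneg_left ih hA.p_pos.le
      _ ≤ _ := h1

theorem opIter_logHolder (hA : UniformlyContracting θ T A good α ξ s B p N) {ω : Ω}
    (hω : ω ∈ good) {Q : ℝ} (hQ0 : 0 ≤ Q) (hQ : s * (Q + B) ≤ Q) {g : X → ℝ}
    (hg : LogHolder α ξ Q g) (n : ℕ) : LogHolder α ξ Q (opIter θ A n ω g) := by
  induction n with
  | zero => exact hg
  | succ n ih => exact (hA.logHolder _ (hA.shift_iterate hω n) Q _ hQ0 ih).mono hQ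

/-- A Doeblin step. Within distance `ξ` of a maximum point `x₀`, `g` is at least `exp (-(Q ξ^α)) g
x₀`, and points this close reach all of `X` in `N` steps, so the `N`-th image is at least `c g x₀`
everywhere. The constant `η c g x₀` is split off: the supremum drops by the factor `1 - η c`, and
the strict contraction of logarithmic Hölder constants pays for the loss `(1 - η)⁻¹` caused by
subtracting. -/
theorem exists_opIter_decomposition [CompactSpace X] [Nonempty X]
    (hA : UniformlyContracting θ T A good α ξ s B p N)
    {Q η : ℝ} (hQ0 : 0 ≤ Q) (hη0 : 0 < η) (hη1 : η < 1) (hQη : s * (Q + B) / (1 - η) ≤ Q) {ω : Ω}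
    (hω : ω ∈ good) {g : X → ℝ} (hg : LogHolder α ξ Q g) {G : ℝ} (hG : ∀ x, g x ≤ G) :
    ∃ (a : ℝ) (g' : X → ℝ), LogHolder α ξ Q g' ∧
      (∀ x, g' x ≤ (1 - η * (p ^ N * Real.exp (-(Q * ξ ^ α)))) * G) ∧
      opIter θ A N ω g = fun x => g' x + a := by
  set c := p ^ N * Real.exp (-(Q * ξ ^ α)) with hc
  have hp := hA.p_pos
  have hξ := hA.xi_pos
  have hα := hA.alpha_pos
  have hc0 : 0 < c := by positivity
  have hc1 : c ≤ 1 := by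
    have h1 : p ^ N ≤ 1 := pow_le_one₀ hp.le hA.p_le_one
    have h2 : Real.exp (-(Q * ξ ^ α)) ≤ 1 := Real.exp_le_one_iff.2 (by
      have : 0 ≤ Q * ξ ^ α := by positivity
      linarith)
    exact mul_le_one₀ h1 (Real.exp_pos _).le h2
  have hQ1 : 0 ≤ s * (Q + B) := mul_nonneg hA.s_nonneg (add_nonneg hQ0 hA.B_nonneg)
  have hQQ : s * (Q + B) ≤ Q := by
    refine le_trans ?_ hQη
    rw [le_div_iff₀ (by linarith)]
    nlinarith
  obtain ⟨x₀, -, hx₀⟩ := isCompact_univ.exists_isMaxOn Set.univ_nonempty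
    (hg.continuous hα hξ).continuousOn
  have hx₀' : ∀ x, g x ≤ g x₀ := fun x => hx₀ (Set.mem_univ x)
  have hg0 := hg.pos x₀
  have hq : LogHolder α ξ (s * (Q + B)) (opIter θ A N ω g) := by
    -- The last of the `N` steps yields the smaller constant `s * (Q + B)`, leaving room for the
    -- subtraction.
    obtain ⟨n, rfl⟩ : ∃ n, N = n + 1 := ⟨N - 1, by have := hA.N_pos; omega⟩
    exact hA.logHolder _ (hA.shift_iterate hω n) Q _ hQ0 (hA.opIter_logHolder hω hQ0 hQQ hg n)
  have hlow : ∀ x, c * g x₀ ≤ opIter θ A N ω g x := by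
    intro x
    obtain ⟨y, hy, rfl⟩ := hA.exact ω hω x₀ x
    refine le_trans ?_ (hA.opIter_lower hω (fun x => (hg.pos x).le) N y)
    rw [hc, mul_assoc]
    refine mul_le_mul_of_nonneg_left ?_ (by positivity)
    rw [Real.exp_neg, ← div_eq_inv_mul, div_le_iff₀' (Real.exp_pos _)]
    refine (hg.le _ _ hy).trans (mul_le_mul_of_nonneg_right ?_ (hg.pos y).le)
    refine Real.exp_le_exp.2 (mul_le_mul_of_nonneg_left ?_ hQ0)
    exact Real.rpow_le_rpow dist_nonneg hy.le hα.le
  have hup : ∀ x, opIter θ A N ω g x ≤ g x₀ := fun x =>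
    (hA.opIter_mem_Icc hω (a := 0) (fun x => ⟨(hg.pos x).le, hx₀' x⟩) N x).2
  refine ⟨η * (c * g x₀), fun x => opIter θ A N ω g x - η * (c * g x₀), ?_, ?_, ?_⟩
  · exact (hq.sub_const hQ1 hη0.le hη1
      (fun x => mul_le_mul_of_nonneg_left (hlow x) hη0.le)).mono hQη
  · intro x
    have h1 := hup x
    have h2 : η * c ≤ 1 := mul_le_one₀ hη1.le hc0.le hc1
    have h3 := hG x₀
    nlinarith
  · funext x; ring

/-- The constants split off pass through the operators unchanged, so only the last remainder, lying
between `0` and its geometrically decaying bound, contributes to the oscillation. -/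
theorem exists_opIter_mul_mem_Icc [CompactSpace X] [Nonempty X]
    (hA : UniformlyContracting θ T A good α ξ s B p N)
    {Q η : ℝ} (hQ0 : 0 ≤ Q) (hη0 : 0 < η) (hη1 : η < 1) (hQη : s * (Q + B) / (1 - η) ≤ Q)
    (n : ℕ) {ω : Ω} (hω : ω ∈ good) {g : X → ℝ} (hg : LogHolder α ξ Q g) {G : ℝ}
    (hG : ∀ x, g x ≤ G) :
    ∃ a, ∀ x, opIter θ A (N * n) ω g x ∈
      Set.Icc a (a + (1 - η * (p ^ N * Real.exp (-(Q * ξ ^ α)))) ^ n * G) := by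
  induction n generalizing ω g G with
  | zero =>
    refine ⟨0, fun x => ⟨(hg.pos x).le, ?_⟩⟩
    simpa [opIter] using hG x
  | succ n ih =>
    obtain ⟨a, g', hg', hG', heq⟩ :=
      hA.exists_opIter_decomposition hQ0 hη0 hη1 hQη hω hg hG
    obtain ⟨a', ha'⟩ := ih (hA.shift_iterate hω N) hg' hG'
    refine ⟨a' + a, fun x => ?_⟩
    have h1 : opIter θ A (N * (n + 1)) ω g x = opIter θ A (N * n) (θ^[N] ω) g' x + a := by
      rw [mul_add, mul_one, add_comm (N * n) N, opIter_add, heq]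
      have := congrFun (hA.opIter_sub_const (hA.shift_iterate hω N) g' (-a) (N * n)) x
      simpa using this
    have h2 := ha' x
    rw [h1]
    refine ⟨by linarith [h2.1], ?_⟩
    have h3 := h2.2
    rw [← mul_assoc, ← pow_succ] at h3
    linarith

/-- Exponential decay of the oscillation of `A_ω^n g`, uniformly in `ω` and in functions `g`
with a fixed logarithmic Hölder constant. -/
theorem exists_oscillation_decay [CompactSpace X] [Nonempty X]
    (hA : UniformlyContracting θ T A good α ξ s B p N) :
    ∃ Q C t : ℝ, 0 < Q ∧ s * (Q + B) ≤ Q ∧ 0 < C ∧ 0 < t ∧ t < 1 ∧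
      ∀ (n : ℕ), ∀ ω ∈ good, ∀ (g : X → ℝ) (G : ℝ), LogHolder α ξ Q g → (∀ x, g x ≤ G) →
        ∃ a, ∀ x, opIter θ A n ω g x ∈ Set.Icc a (a + C * t ^ n * G) := by
  have hs := hA.s_lt_one
  have hs0 := hA.s_nonneg
  have hB := hA.B_nonneg
  -- This `Q` solves `s * (Q + B) = Q - 1`. With `η = 1 / (2 * Q)` one has `(1 - η) * Q = Q - 1 /
  -- 2`, so half of the gap remains.
  set Q := (s * B + 1) / (1 - s) with hQ
  have hQ1 : 1 ≤ Q := by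
    rw [hQ, le_div_iff₀ (by linarith)]; nlinarith
  have hfix : s * (Q + B) = Q - 1 := by
    have : Q * (1 - s) = s * B + 1 := by rw [hQ]; field_simp [show (1 - s) ≠ 0 by linarith]
    linarith
  set η := 1 / (2 * Q) with hη
  have hη0 : 0 < η := by positivity
  have hη1 : η < 1 := by rw [hη, div_lt_one (by linarith)]; linarith
  have hQη : s * (Q + B) / (1 - η) ≤ Q := by
    rw [hfix, div_le_iff₀ (by linarith), hη]
    have : Q * (1 - 1 / (2 * Q)) = Q - 1 / 2 := by field_simp
    rw [this]; linarith
  set r := 1 - η * (p ^ N * Real.exp (-(Q * ξ ^ α))) with hr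
  have hp := hA.p_pos
  have hξ := hA.xi_pos
  have hr1 : r < 1 := by
    have : 0 < η * (p ^ N * Real.exp (-(Q * ξ ^ α))) := by positivity
    linarith
  have hr0 : 0 < r := by
    have h1 : p ^ N ≤ 1 := pow_le_one₀ hp.le hA.p_le_one
    have h2 : Real.exp (-(Q * ξ ^ α)) ≤ 1 := Real.exp_le_one_iff.2 (by
      have : 0 ≤ Q * ξ ^ α := by positivity
      linarith)
    have h3 := mul_le_one₀ h1 (Real.exp_pos _).le h2
    have : η * (p ^ N * Real.exp (-(Q * ξ ^ α))) ≤ η * 1 := mul_le_mul_of_nonneg_left h3 hη0.le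
    linarith
  have hN : (N : ℝ) ≠ 0 := by exact_mod_cast hA.N_pos.ne'
  set t := r ^ (1 / (N : ℝ)) with ht
  have ht0 : 0 < t := Real.rpow_pos_of_pos hr0 _
  have ht1 : t < 1 := Real.rpow_lt_one hr0.le hr1 (by positivity)
  have htN : t ^ N = r := by
    rw [ht, ← Real.rpow_natCast, ← Real.rpow_mul hr0.le, one_div_mul_cancel hN, Real.rpow_one]
  refine ⟨Q, r⁻¹, t, by linarith, by linarith, inv_pos.2 hr0, ht0, ht1, ?_⟩
  intro n ω hω g G hg hG
  obtain ⟨a, ha⟩ := hA.exists_opIter_mul_mem_Icc (by linarith) hη0 hη1 hQη (n / N) hω hg hG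
  refine ⟨a, fun x => ?_⟩
  have h1 := hA.opIter_mem_Icc (hA.shift_iterate hω (N * (n / N))) ha (n % N) x
  rw [← opIter_add, Nat.div_add_mod] at h1
  refine ⟨h1.1, h1.2.trans ?_⟩
  have hG0 : 0 ≤ G := (hg.pos x).le.trans (hG x)
  -- The factor `r⁻¹ = t ^ (-N)` covers the fewer than `N` leftover steps.
  have h2 : r ^ (n / N) ≤ r⁻¹ * t ^ n := by
    rw [← div_eq_inv_mul, le_div_iff₀ hr0]
    conv_rhs => rw [← Nat.div_add_mod n N, pow_add, pow_mul, htN]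
    refine mul_le_mul_of_nonneg_left ?_ (pow_nonneg hr0.le _)
    rw [← htN]
    exact pow_le_pow_of_le_one ht0.le ht1.le (Nat.mod_lt _ hA.N_pos).le
  have := mul_le_mul_of_nonneg_right h2 hG0
  linarith

end UniformlyContracting

end Contraction

/-! ### A uniform logarithmic Hölder constant for the eigenfunction -/

section Eigenfunction

/-- The set of `ξ`-close pairs is open, so pairs from the dense set are dense in it, and the
inequality is closed. Only countably many conditions are then needed, which makes the corresponding
event measurable. -/
theorem LogHolder.of_dense {X ι : Type*} [MetricSpace X] {α ξ Q : ℝ} (hα : 0 ≤ α) {g : X → ℝ}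
    (hg : Continuous g) (hpos : ∀ x, 0 < g x) {d : ι → X} (hd : DenseRange d)
    (hle : ∀ i j, dist (d i) (d j) < ξ →
      g (d i) ≤ Real.exp (Q * dist (d i) (d j) ^ α) * g (d j)) : LogHolder α ξ Q g where
  pos := hpos
  le x x' hx := by
    have hU : IsOpen {q : X × X | dist q.1 q.2 < ξ} := isOpen_lt (by fun_prop) continuous_const
    have hS : IsClosed {q : X × X | g q.1 ≤ Real.exp (Q * dist q.1 q.2 ^ α) * g q.2} := by
      refine isClosed_le (hg.comp continuous_fst) ?_
      have h1 : Continuous fun q : X × X => dist q.1 q.2 ^ α :=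
        continuous_dist.rpow_const fun _ => Or.inr hα
      exact (Real.continuous_exp.comp (continuous_const.mul h1)).mul (hg.comp continuous_snd)
    have h1 := (hd.prodMap hd).open_subset_closure_inter hU
    have h2 : closure ({q : X × X | dist q.1 q.2 < ξ} ∩ Set.range (Prod.map d d)) ⊆
        {q : X × X | g q.1 ≤ Real.exp (Q * dist q.1 q.2 ^ α) * g q.2} := by
      refine closure_minimal ?_ hS
      rintro _ ⟨hq, ⟨i, j⟩, rfl⟩
      exact hle i j hq
    exact h2 (h1 (show (x, x') ∈ {q : X × X | dist q.1 q.2 < ξ} from hx))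

theorem exists_logHolder_of_isHolder {X : Type*} [MetricSpace X] [CompactSpace X] [Nonempty X]
    {α ξ : ℝ} (hα : 0 < α) (hξ : 0 < ξ) {g : X → ℝ} (hg : IsHolder α ξ g)
    (hpos : ∀ x, 0 < g x) : ∃ n : ℕ, LogHolder α ξ n g := by
  obtain ⟨C, hC, -⟩ := ENNReal.lt_iff_exists_nnreal_btwn.1 (show holderNorm α ξ g < ⊤ from hg)
  obtain ⟨-, h2⟩ := exists_bound_of_holderNorm_lt hC
  have hcont : Continuous g := continuous_of_locally_holder hα hξ h2
  obtain ⟨x₀, -, hx₀⟩ := isCompact_univ.exists_isMinOn Set.univ_nonempty hcont.continuousOn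
  obtain ⟨n, hn⟩ := exists_nat_ge ((C : ℝ) / g x₀)
  exact ⟨n, (LogHolder.of_lower_bound (hpos x₀) C.2 (fun x => hx₀ (Set.mem_univ x)) h2).mono hn⟩

/-- Data of one fiber: contraction of inverse branches and bounds for the potential. -/
structure RegularMap {X : Type*} [MetricSpace X] (α ξ c D H : ℝ) (τ : X → X) (φ : X → ℝ) :
    Prop where
  paired : PairedPreimages ξ c D τ
  surjective : Function.Surjective τ
  abs_le : ∀ x, |φ x| ≤ H
  holder : ∀ x x', dist x x' < ξ → |φ x - φ x'| ≤ H * dist x x' ^ α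

variable {Ω X : Type*} [MeasurableSpace Ω] [MetricSpace X] [CompactSpace X] [Nonempty X]
  [MeasurableSpace X] {P : Measure Ω} [IsProbabilityMeasure P]

/-- Each `h_ω` has some finite constant, possibly unbounded in `ω`. The eigenfunction equation
improves a constant `R` at `ω` to `s * (H + R)` at `θ ω`; as `P` is invariant, the event of having
constant `R` is no more likely than that of having the improved one. Iterating drives every `R`
towards the fixed point, so one constant works almost surely. -/
theorem exists_ae_logHolder_of_eigenfunction {θ : Ω → Ω} (hθ : MeasurePreserving θ P P)
    {T : Ω → X → X} {φ h : Ω → X → ℝ} {lam : Ω → ℝ} {α ξ c D H : ℝ} (hα : 0 < α) (hξ : 0 < ξ)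
    (hc0 : 0 ≤ c) (hc1 : c < 1) (hH : 0 ≤ H)
    (hreg : ∀ᵐ ω ∂P, RegularMap α ξ c D H (T ω) (φ ω))
    (hmeas : Measurable (fun p : Ω × X => h p.1 p.2))
    (hlam : ∀ᵐ ω ∂P, 0 < lam ω) (hpos : ∀ᵐ ω ∂P, ∀ x, 0 < h ω x)
    (hhol : ∀ᵐ ω ∂P, IsHolder α ξ (h ω))
    (heq : ∀ᵐ ω ∂P, ∀ x, transferOpZero T φ ω (h ω) x = lam ω * h (θ ω) x) :
    ∃ Q : ℝ, 0 ≤ Q ∧ ∀ᵐ ω ∂P, LogHolder α ξ Q (h ω) := by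
  set d := TopologicalSpace.denseSeq X with hd
  have hdense : DenseRange d := TopologicalSpace.denseRange_denseSeq X
  set E : ℝ → Set Ω := fun R => {ω | ∀ i j, dist (d i) (d j) < ξ →
    h ω (d i) ≤ Real.exp (R * dist (d i) (d j) ^ α) * h ω (d j)} with hE
  have hhm : ∀ x, Measurable fun ω => h ω x := fun x => hmeas.comp measurable_prodMk_right
  have hEm : ∀ R, MeasurableSet (E R) := by
    intro R
    simp only [hE, Set.ofPred_forall]
    refine MeasurableSet.iInter fun i => MeasurableSet.iInter fun j =>
      MeasurableSet.iInter fun _ => ?_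
    exact measurableSet_le (hhm _) ((hhm _).const_mul _)
  have hmem : ∀ {R ω}, LogHolder α ξ R (h ω) → ω ∈ E R := fun hL i j hij => hL.le _ _ hij
  have hlog : ∀ᵐ ω ∂P, ∃ n : ℕ, LogHolder α ξ n (h ω) := by
    filter_upwards [hpos, hhol] with ω h1 h2 using exists_logHolder_of_isHolder hα hξ h2 h1
  have hback : ∀ᵐ ω ∂P, ∀ R, ω ∈ E R → LogHolder α ξ R (h ω) := by
    filter_upwards [hlog] with ω ⟨n, hn⟩ R hR
    exact LogHolder.of_dense hα.le (hn.continuous hα hξ) hn.pos hdense hR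
  set s := c ^ α with hs
  have hs0 : 0 ≤ s := Real.rpow_nonneg hc0 α
  have hs1 : s < 1 := Real.rpow_lt_one hc0 hc1 hα
  have hstep : ∀ R, 0 ≤ R → P (E R) ≤ P (E (s * (H + R))) := by
    intro R hR
    rw [← hθ.measure_preimage (hEm (s * (H + R))).nullMeasurableSet]
    refine measure_mono_ae ?_
    filter_upwards [hback, hreg, hlam, heq] with ω h1 h2 h3 h4 hω
    refine hmem ?_
    have h5 := h2.paired.logHolder_weightedTransfer hξ hα hc0 hc1.le h2.surjective
      (add_nonneg hH hR) (LogHolder.exp_comp h2.holder) (h1 R hω)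
    have h6 : h (θ ω) = fun x => (lam ω)⁻¹ *
        weightedTransfer (T ω) (fun y => Real.exp (φ ω y)) (h ω) x := by
      funext x
      have := h4 x
      unfold transferOpZero at this
      rw [this, inv_mul_cancel_left₀ h3.ne']
    rw [h6]
    exact h5.const_mul (inv_pos.2 h3)
  -- The fixed point of `R ↦ s * (H + R)`. Iterates only converge to it, hence the bound `1 + Qs`
  -- below.
  set Qs := s * H / (1 - s) with hQs
  have hQs0 : 0 ≤ Qs := div_nonneg (mul_nonneg hs0 hH) (by linarith)
  have hfix : s * (H + Qs) = Qs := by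
    have : Qs * (1 - s) = s * H := by rw [hQs]; field_simp [show (1 - s) ≠ 0 by linarith]
    linarith
  have hiter : ∀ R, 0 ≤ R → ∀ n : ℕ, P (E R) ≤ P (E (s ^ n * R + Qs)) := by
    intro R hR n
    induction n with
    | zero =>
      refine measure_mono_ae ?_
      filter_upwards [hback] with ω h1 hω
      exact hmem ((h1 R hω).mono (by simpa using hQs0))
    | succ n ih =>
      refine ih.trans ((hstep _ (by positivity)).trans_eq ?_)
      congr 2
      rw [pow_succ]
      linear_combination hfix
  have hle : ∀ n : ℕ, P (E n) ≤ P (E (1 + Qs)) := by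
    intro R
    have hlim : Tendsto (fun n : ℕ => s ^ n * (R : ℝ)) atTop (𝓝 0) := by
      simpa using (tendsto_pow_atTop_nhds_zero_of_lt_one hs0 hs1).mul_const (R : ℝ)
    obtain ⟨n, hn⟩ := (hlim.eventually (gt_mem_nhds (zero_lt_one' ℝ))).exists
    refine (hiter R (Nat.cast_nonneg R) n).trans (measure_mono_ae ?_)
    filter_upwards [hback] with ω h1 hω
    exact hmem ((h1 _ hω).mono (by linarith))
  have hfull : 1 ≤ P (E (1 + Qs)) := by
    have h1 : P (⋃ n : ℕ, {ω | LogHolder α ξ n (h ω)}) = 1 := by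
      have : (⋃ n : ℕ, {ω | LogHolder α ξ n (h ω)}) =ᵐ[P] Set.univ := by
        rw [eventuallyEq_univ]
        filter_upwards [hlog] with ω hω
        simpa using hω
      rw [measure_congr this, measure_univ]
    have hmono : Monotone fun n : ℕ => {ω | LogHolder α ξ n (h ω)} := fun a b hab ω hω =>
      LogHolder.mono hω (by exact_mod_cast hab)
    rw [← h1, hmono.measure_iUnion]
    exact iSup_le fun n => (measure_mono fun ω hω => hmem hω).trans (hle n)
  refine ⟨1 + Qs, by linarith, ?_⟩
  have h2 : ∀ᵐ ω ∂P, ω ∈ E (1 + Qs) :=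
    (mem_ae_iff_prob_eq_one (hEm _)).2 (le_antisymm prob_le_one hfull)
  filter_upwards [h2, hback] with ω h3 h4 using h4 _ h3

end Eigenfunction

/-! ### Bounded ratio of the values of the eigenfunction -/

section EigenfunctionRatio

variable {Ω X : Type*} [MetricSpace X] [CompactSpace X]

/-- Comparison of the values of the eigenfunction after the covering time. -/
theorem eigenfunction_ratio_le {θ : Ω → Ω} {T : Ω → X → X} {φ h : Ω → X → ℝ} {lam : Ω → ℝ}
    {α ξ c D H Q : ℝ} {N : ℕ} {ω : Ω} (hα : 0 < α) (hξ : 0 < ξ) (hD : 0 ≤ D) (hQ : 0 ≤ Q)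
    (hreg : ∀ n, RegularMap α ξ c D H (T (θ^[n] ω)) (φ (θ^[n] ω)))
    (hlam : ∀ n, 0 < lam (θ^[n] ω))
    (hlog : ∀ n, LogHolder α ξ Q (h (θ^[n] ω)))
    (heq : ∀ n, ∀ x, transferOpZero T φ (θ^[n] ω) (h (θ^[n] ω)) x =
      lam (θ^[n] ω) * h (θ^[n + 1] ω) x)
    (hexact : ∀ x₀ x : X, ∃ y, dist x₀ y < ξ ∧ fiberIter θ T N ω y = x) (x x' : X) :
    h (θ^[N] ω) x ≤ (D * Real.exp H) ^ N * Real.exp H ^ N * Real.exp (Q * ξ ^ α) *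
      h (θ^[N] ω) x' := by
  -- The product of eigenvalues needs no bounds: it cancels between the lower estimate `hlow`, which
  -- keeps one preimage branch, and the upper estimate `hup`, which counts at most `D` preimages per
  -- step.
  set Λ : ℕ → ℝ := fun n => ∏ j ∈ Finset.range n, lam (θ^[j] ω) with hΛ
  have hΛ0 : ∀ n, 0 < Λ n := fun n => Finset.prod_pos fun j _ => hlam j
  have hΛs : ∀ n, Λ (n + 1) = Λ n * lam (θ^[n] ω) := fun n => Finset.prod_range_succ _ n
  have hlow : ∀ n y, h ω y ≤ Real.exp H ^ n * (Λ n * h (θ^[n] ω) (fiberIter θ T n ω y)) := by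
    intro n y
    induction n with
    | zero => simp [hΛ, fiberIter]
    | succ n ih =>
      have h1 := (hreg n).paired.le_weightedTransfer hξ
        (w := fun y => Real.exp (φ (θ^[n] ω) y)) (fun x => (Real.exp_pos _).le)
        (fun x => ((hlog n).pos x).le) (fiberIter θ T n ω y)
      have h2 := heq n (T (θ^[n] ω) (fiberIter θ T n ω y))
      rw [transferOpZero] at h2
      rw [h2] at h1
      have h3 : Real.exp (-H) ≤ Real.exp (φ (θ^[n] ω) (fiberIter θ T n ω y)) :=
        Real.exp_le_exp.2 (neg_le_of_abs_le ((hreg n).abs_le _))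
      have h4 := (mul_le_mul_of_nonneg_right h3 ((hlog n).pos _).le).trans h1
      rw [Real.exp_neg, ← div_eq_inv_mul, div_le_iff₀' (Real.exp_pos _)] at h4
      refine ih.trans ?_
      have h5 := mul_le_mul_of_nonneg_left h4
        (mul_nonneg (pow_nonneg (Real.exp_pos H).le n) (hΛ0 n).le)
      rw [hΛs, fiberIter, pow_succ]
      linarith
  obtain ⟨x₀, -, hx₀⟩ := isCompact_univ.exists_isMaxOn ⟨x, Set.mem_univ x⟩
    ((hlog 0).continuous hα hξ).continuousOn
  have hx₀' : ∀ x, h ω x ≤ h ω x₀ := fun x => hx₀ (Set.mem_univ x)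
  have h0pos : 0 < h ω x₀ := (hlog 0).pos x₀
  have hup : ∀ n x, Λ n * h (θ^[n] ω) x ≤ (D * Real.exp H) ^ n * h ω x₀ := by
    intro n
    induction n with
    | zero => intro x; simpa [hΛ] using hx₀' x
    | succ n ih =>
      intro x
      have h1 := (hreg n).paired.weightedTransfer_le hξ
        (w := fun y => Real.exp (φ (θ^[n] ω) y)) (g := h (θ^[n] ω)) (W := Real.exp H)
        (G := (Λ n)⁻¹ * ((D * Real.exp H) ^ n * h ω x₀)) (fun x => (Real.exp_pos _).le)
        (by have := hΛ0 n; positivity)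
        (fun x => Real.exp_le_exp.2 ((abs_le.1 ((hreg n).abs_le x)).2))
        (fun x => by rw [← div_eq_inv_mul, le_div_iff₀' (hΛ0 n)]; exact ih x) x
      have h2 := heq n x
      rw [transferOpZero] at h2
      rw [h2] at h1
      have h3 := mul_le_mul_of_nonneg_left h1 (hΛ0 n).le
      rw [hΛs, mul_assoc]
      refine h3.trans_eq ?_
      have := (hΛ0 n).ne'
      field_simp
      ring
  obtain ⟨y, hy, rfl⟩ := hexact x₀ x'
  have h1 := (hlog 0).le x₀ y hy
  have h2 : Real.exp (Q * dist x₀ y ^ α) ≤ Real.exp (Q * ξ ^ α) :=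
    Real.exp_le_exp.2 (mul_le_mul_of_nonneg_left
      (Real.rpow_le_rpow dist_nonneg hy.le hα.le) hQ)
  have h3 := h1.trans (mul_le_mul_of_nonneg_right h2 ((hlog 0).pos y).le)
  have h4 := h3.trans (mul_le_mul_of_nonneg_left (hlow N y) (Real.exp_pos _).le)
  have h5 := (hup N x).trans (mul_le_mul_of_nonneg_left h4 (by positivity))
  refine le_of_mul_le_mul_left (h5.trans_eq ?_) (hΛ0 N)
  ring

end EigenfunctionRatio

/-! ### The normalized operator and its duality with the Gibbs measures -/

section NormalizedOperator

variable {Ω X : Type*}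

/-- The normalized operator `g ↦ L_0^ω (g h_ω) / (λ_ω h_{θω})`. -/
noncomputable def normalizedOp (θ : Ω → Ω) (T : Ω → X → X) (φ h : Ω → X → ℝ) (lam : Ω → ℝ)
    (ω : Ω) (g : X → ℝ) (x : X) : ℝ :=
  (lam ω)⁻¹ * (transferOpZero T φ ω (fun y => g y * h ω y) x * (h (θ ω) x)⁻¹)

variable [MeasurableSpace X]

theorem integral_withDensity_ofReal {μ : Measure X} {r : X → ℝ} (hr : Measurable r)
    (hr0 : ∀ x, 0 ≤ r x) (f : X → ℝ) :
    ∫ x, f x ∂(μ.withDensity fun x => ENNReal.ofReal (r x)) = ∫ x, f x * r x ∂μ := by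
  rw [integral_withDensity_eq_integral_toReal_smul hr.ennreal_ofReal (by simp)]
  refine integral_congr_ae (Eventually.of_forall fun x => ?_)
  simp [ENNReal.toReal_ofReal (hr0 x), mul_comm]

variable [MeasurableSpace Ω]

theorem integral_gibbs {h : Ω → X → ℝ} {ν : Kernel Ω X} {ω : Ω} (hm : Measurable (h ω))
    (h0 : ∀ x, 0 ≤ h ω x) (f : X → ℝ) :
    ∫ x, f x ∂(gibbs h ν ω) = ∫ x, f x * h ω x ∂(ν ω) :=
  integral_withDensity_ofReal hm h0 f

variable [MetricSpace X]

/-- The properties, with uniform constants, of a single fiber of a random expanding system with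
its Ruelle-Perron-Frobenius triplet. -/
structure RegularFiber (θ : Ω → Ω) (T : Ω → X → X) (φ u h : Ω → X → ℝ) (lam : Ω → ℝ)
    (ν : Kernel Ω X) (α ξ c D H U Q K : ℝ) (N : ℕ) (ω : Ω) : Prop where
  map : RegularMap α ξ c D H (T ω) (φ ω)
  observable_le : ∀ x, |u ω x| ≤ U
  observable_holder : ∀ x x', dist x x' < ξ → |u ω x - u ω x'| ≤ U * dist x x' ^ α
  eigenvalue_pos : 0 < lam ω
  logHolder : LogHolder α ξ Q (h ω)
  ratio : ∀ x x', h ω x ≤ K * h ω x'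
  eigenfunction_eq : ∀ x, transferOpZero T φ ω (h ω) x = lam ω * h (θ ω) x
  conformal : ∀ g : X → ℝ, Continuous g →
    ∫ x, transferOpZero T φ ω g x ∂(ν (θ ω)) = lam ω * ∫ x, g x ∂(ν ω)
  normalized : ∫ x, h ω x ∂(ν ω) = 1
  exact : ∀ x₀ x : X, ∃ y, dist x₀ y < ξ ∧ fiberIter θ T N ω y = x

variable {θ : Ω → Ω} {T : Ω → X → X} {φ u h : Ω → X → ℝ}
  {lam : Ω → ℝ} {ν : Kernel Ω X} {α ξ c D H U Q K : ℝ} {N : ℕ} {ω : Ω}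

/-- Constants are fixed by the eigenfunction equation. A single preimage `y` contributes at least
`exp (-H) g(y) h(y)`, while the denominator `λ h = L_0 h` at its image is at most `D exp H K h(y)`;
this is the weight `p`. In `B`, the term `Q` comes from multiplying by `h_ω` before the contraction,
and `Q / c ^ α` from dividing by `h_{θω}` after it. -/
theorem uniformlyContracting_normalizedOp (hα : 0 < α) (hξ : 0 < ξ) (hc0 : 0 < c) (hc1 : c < 1)
    (hD : 1 ≤ D) (hH : 0 ≤ H) (hQ : 0 ≤ Q) (hK : 1 ≤ K) (hN : 0 < N) :
    UniformlyContracting θ T (normalizedOp θ T φ h lam)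
      {ω | ∀ n, RegularFiber θ T φ u h lam ν α ξ c D H U Q K N (θ^[n] ω)} α ξ (c ^ α)
      (H + Q + Q / c ^ α) ((D * Real.exp H * K * Real.exp H)⁻¹) N := by
  have hs0 : 0 < c ^ α := Real.rpow_pos_of_pos hc0 α
  have hexp : 1 ≤ Real.exp H := Real.one_le_exp hH
  have h1DK : 1 ≤ D * Real.exp H * K * Real.exp H :=
    one_le_mul_of_one_le_of_one_le (one_le_mul_of_one_le_of_one_le
      (one_le_mul_of_one_le_of_one_le hD hexp) hK) hexp
  have h0 : ∀ {ω}, (∀ n, RegularFiber θ T φ u h lam ν α ξ c D H U Q K N (θ^[n] ω)) →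
      RegularFiber θ T φ u h lam ν α ξ c D H U Q K N ω := fun hω => hω 0
  have h1 : ∀ {ω}, (∀ n, RegularFiber θ T φ u h lam ν α ξ c D H U Q K N (θ^[n] ω)) →
      RegularFiber θ T φ u h lam ν α ξ c D H U Q K N (θ ω) := fun hω => hω 1
  have hsub : ∀ ω, (∀ n, RegularFiber θ T φ u h lam ν α ξ c D H U Q K N (θ^[n] ω)) →
      ∀ (g : X → ℝ) (a : ℝ) (x : X), normalizedOp θ T φ h lam ω (fun y => g y - a) x =
        normalizedOp θ T φ h lam ω g x - a := by
    intro ω hω g a x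
    have h2 := (h0 hω).map.paired.weightedTransfer_sub_mul hξ (fun y => Real.exp (φ ω y))
      (fun y => g y * h ω y) (h ω) a x
    have h3 := (h0 hω).eigenfunction_eq x
    have h4 := ((h1 hω).logHolder.pos x).ne'
    have h5 := (h0 hω).eigenvalue_pos.ne'
    simp only [normalizedOp, transferOpZero] at h2 h3 ⊢
    simp only [sub_mul]
    rw [h2, h3]
    field_simp
  have hnonneg : ∀ ω, (∀ n, RegularFiber θ T φ u h lam ν α ξ c D H U Q K N (θ^[n] ω)) →
      ∀ g : X → ℝ, (∀ y, 0 ≤ g y) → ∀ x, 0 ≤ normalizedOp θ T φ h lam ω g x := by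
    intro ω hω g hg x
    have h2 := (h0 hω).map.paired.weightedTransfer_nonneg hξ
      (w := fun y => Real.exp (φ ω y)) (g := fun y => g y * h ω y)
      (fun y => (Real.exp_pos _).le) (fun y => mul_nonneg (hg y) ((h0 hω).logHolder.pos y).le) x
    exact mul_nonneg (inv_nonneg.2 (h0 hω).eigenvalue_pos.le)
      (mul_nonneg h2 (inv_nonneg.2 ((h1 hω).logHolder.pos x).le))
  refine ⟨hα, hξ, hs0.le, Real.rpow_lt_one hc0.le hc1 hα, by positivity, by positivity,
    inv_le_one_of_one_le₀ h1DK, hN, ?_, ?_, ?_, hsub, ?_, ?_, ?_⟩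
  · intro ω hω n
    exact hω (n + 1)
  · intro ω hω a x
    have h2 := hsub ω hω (fun _ => 0) (-a) x
    simp only [sub_neg_eq_add, zero_add] at h2
    rw [h2]
    have h3 := (h0 hω).map.paired.weightedTransfer_sub_mul hξ (fun y => Real.exp (φ ω y))
      (h ω) (h ω) 1 x
    simp only [one_mul, sub_self] at h3
    simp [normalizedOp, transferOpZero, h3]
  · intro ω hω g g' hgg x
    have h2 := hnonneg ω hω (fun y => g' y - g y) (fun y => sub_nonneg.2 (hgg y)) x
    have h3 := (h0 hω).map.paired.weightedTransfer_sub_mul hξ (fun y => Real.exp (φ ω y))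
      (fun y => g' y * h ω y) (fun y => g y * h ω y) 1 x
    simp only [one_mul] at h3
    simp only [normalizedOp, transferOpZero, sub_mul] at h2 ⊢
    rw [h3] at h2
    linarith
  · intro ω hω g hg y
    have h2 := (h0 hω).map.paired.le_weightedTransfer hξ
      (w := fun y => Real.exp (φ ω y)) (g := fun y => g y * h ω y)
      (fun y => (Real.exp_pos _).le) (fun y => mul_nonneg (hg y) ((h0 hω).logHolder.pos y).le) y
    have hy := (h0 hω).logHolder.pos y
    have h3 := (h0 hω).map.paired.weightedTransfer_le hξ
      (w := fun y => Real.exp (φ ω y)) (g := h ω) (W := Real.exp H) (G := K * h ω y)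
      (fun y => (Real.exp_pos _).le) (by positivity)
      (fun x => Real.exp_le_exp.2 ((abs_le.1 ((h0 hω).map.abs_le x)).2))
      (fun x => (h0 hω).ratio x y) (T ω y)
    have h4 := (h0 hω).eigenfunction_eq (T ω y)
    have hlam := (h0 hω).eigenvalue_pos
    have hpos := (h1 hω).logHolder.pos (T ω y)
    simp only [transferOpZero] at h4
    rw [h4] at h3
    have h5 : Real.exp (-H) ≤ Real.exp (φ ω y) :=
      Real.exp_le_exp.2 (neg_le_of_abs_le ((h0 hω).map.abs_le _))
    have h6 := (mul_le_mul_of_nonneg_right h5 (mul_nonneg (hg y) hy.le)).trans h2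
    have h7 : normalizedOp θ T φ h lam ω g (T ω y) = weightedTransfer (T ω)
        (fun y => Real.exp (φ ω y)) (fun y => g y * h ω y) (T ω y) /
          (lam ω * h (θ ω) (T ω y)) := by
      simp only [normalizedOp, transferOpZero]
      field_simp
    rw [h7, le_div_iff₀ (by positivity)]
    refine le_trans ?_ h6
    refine (mul_le_mul_of_nonneg_left h3 (mul_nonneg (by positivity) (hg y))).trans_eq ?_
    rw [Real.exp_neg]
    field_simp
  · intro ω hω R g hR hg
    have h2 := (h0 hω).map.paired.logHolder_weightedTransfer hξ hα hc0.le hc1.le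
      (h0 hω).map.surjective (by positivity) (LogHolder.exp_comp (h0 hω).map.holder)
      (hg.mul (h0 hω).logHolder)
    have h3 := ((h2.mul (h1 hω).logHolder.inv).const_mul
      (inv_pos.2 (h0 hω).eigenvalue_pos))
    refine LogHolder.mono h3 (le_of_eq ?_)
    field_simp
    ring
  · intro ω hω
    exact (h0 hω).exact

variable [BorelSpace X]

/-- The normalized operator is dual to the composition with `T_ω`. -/
theorem RegularFiber.integral_mul_comp
    (hω : RegularFiber θ T φ u h lam ν α ξ c D H U Q K N ω)
    (hθω : RegularFiber θ T φ u h lam ν α ξ c D H U Q K N (θ ω)) (hα : 0 < α) (hξ : 0 < ξ)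
    (hT : Continuous (T ω)) {F g : X → ℝ} (hF : Continuous F) (hg : Continuous g) :
    ∫ x, F x * g (T ω x) ∂(gibbs h ν ω) =
      ∫ x, normalizedOp θ T φ h lam ω F x * g x ∂(gibbs h ν (θ ω)) := by
  have hc := hω.logHolder.continuous hα hξ
  have hc' := hθω.logHolder.continuous hα hξ
  rw [integral_gibbs hc.measurable (fun x => (hω.logHolder.pos x).le),
    integral_gibbs hc'.measurable (fun x => (hθω.logHolder.pos x).le)]
  have h1 := hω.conformal (fun x => F x * h ω x * g (T ω x))
    ((hF.mul hc).mul (hg.comp hT))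
  have h2 : ∫ x, F x * g (T ω x) * h ω x ∂(ν ω) = (lam ω)⁻¹ *
      ∫ x, transferOpZero T φ ω (fun x => F x * h ω x * g (T ω x)) x ∂(ν (θ ω)) := by
    rw [h1, inv_mul_cancel_left₀ hω.eigenvalue_pos.ne']
    exact integral_congr_ae (Eventually.of_forall fun x => by ring)
  rw [h2, ← integral_const_mul]
  refine integral_congr_ae (Eventually.of_forall fun x => ?_)
  have h3 := hω.map.paired.weightedTransfer_mul_comp hξ (fun y => Real.exp (φ ω y))
    (fun x => F x * h ω x) g x
  have h4 := (hθω.logHolder.pos x).ne'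
  simp only [normalizedOp, transferOpZero] at h3 ⊢
  rw [h3]
  field_simp

theorem RegularFiber.isProbabilityMeasure_gibbs [CompactSpace X] [IsMarkovKernel ν]
    (hω : RegularFiber θ T φ u h lam ν α ξ c D H U Q K N ω) (hα : 0 < α) (hξ : 0 < ξ) :
    IsProbabilityMeasure (gibbs h ν ω) := by
  have hc := hω.logHolder.continuous hα hξ
  constructor
  unfold gibbs
  rw [withDensity_apply _ MeasurableSet.univ, Measure.restrict_univ,
    ← ofReal_integral_eq_lintegral_ofReal
      (hc.integrable_of_hasCompactSupport (HasCompactSupport.of_compactSpace _))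
      (Eventually.of_forall fun x => (hω.logHolder.pos x).le), hω.normalized, ENNReal.ofReal_one]

end NormalizedOperator

/-! ### Uniform constants along almost every orbit -/

section FiberIter

variable {Ω X : Type*}

theorem fiberIter_surjective {θ : Ω → Ω} {T : Ω → X → X} (hT : ∀ ω, Function.Surjective (T ω))
    (n : ℕ) (ω : Ω) : Function.Surjective (fiberIter θ T n ω) := by
  induction n with
  | zero => exact fun x => ⟨x, rfl⟩
  | succ n ih => exact (hT _).comp ih

theorem fiberIter_continuous [TopologicalSpace X] {θ : Ω → Ω} {T : Ω → X → X} (hT : ∀ ω, Continuous (T ω))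
    (n : ℕ) (ω : Ω) : Continuous (fiberIter θ T n ω) := by
  induction n with
  | zero => exact continuous_id
  | succ n ih => exact (hT _).comp ih

end FiberIter

section Regularity

variable {Ω X : Type*} [MeasurableSpace Ω] {P : Measure Ω}

theorem ae_forall_iterate {θ : Ω → Ω} (hθ : MeasurePreserving θ P P) {p : Ω → Prop}
    (hp : ∀ᵐ ω ∂P, p ω) : ∀ᵐ ω ∂P, ∀ n, p (θ^[n] ω) :=
  ae_all_iff.2 fun n => (hθ.iterate n).quasiMeasurePreserving.ae hp

variable [MetricSpace X] [MeasurableSpace X]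

theorem StandingAssumptions.exists_regularMap {θ : Ω → Ω} {T : Ω → X → X} {φ u : Ω → X → ℝ}
    {α ξ : ℝ} (hT : StandingAssumptions P θ T φ u α ξ) :
    ∃ c D H : ℝ, 0 < c ∧ c < 1 ∧ 1 ≤ D ∧ 0 ≤ H ∧
      ∀ᵐ ω ∂P, RegularMap α ξ c D H (T ω) (φ ω) := by
  obtain ⟨γ, D, -, -, hpair, ⟨D₀, hD₀⟩, ⟨δ, hδ, hγ⟩⟩ := hT.pairing
  obtain ⟨C, hC⟩ := hT.potential_bounded
  refine ⟨(1 + δ)⁻¹, max D₀ 1, (C + 1 : ℝ≥0), by positivity,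
    inv_lt_one_of_one_lt₀ (by linarith), le_max_right _ _, NNReal.coe_nonneg _, ?_⟩
  filter_upwards [hpair, hD₀, hγ, hC] with ω h1 h2 h3 h4
  obtain ⟨h5, h6⟩ := exists_bound_of_holderNorm_lt (C := C + 1) (lt_of_le_of_lt h4
    (by exact_mod_cast lt_add_one C))
  refine ⟨?_, hT.surjective_map ω, h5, h6⟩
  intro x x' hx
  obtain ⟨k, y, y', hy, hy', hxy, hxy', hk, hd⟩ := h1.2 x x' hx
  refine ⟨k, y, y', hy, hy', hxy, hxy', (hk.trans h2).trans (le_max_left _ _), fun i => ?_⟩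
  refine (hd i).trans (mul_le_mul_of_nonneg_right ?_ dist_nonneg)
  exact inv_anti₀ (by linarith) (by linarith)

/-- Covering persists after the random covering time because the remaining fiber maps are
surjective; adding `1` to the bound makes the common time positive. -/
theorem StandingAssumptions.exists_covering_time {θ : Ω → Ω} {T : Ω → X → X} {φ u : Ω → X → ℝ}
    {α ξ : ℝ} (hT : StandingAssumptions P θ T φ u α ξ) :
    ∃ N : ℕ, 0 < N ∧ ∀ᵐ ω ∂P, ∀ x₀ x : X, ∃ y, dist x₀ y < ξ ∧ fiberIter θ T N ω y = x := by
  obtain ⟨N, -, hex, N₀, hN₀⟩ := hT.exact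
  refine ⟨N₀ + 1, Nat.succ_pos _, ?_⟩
  filter_upwards [hex, hN₀] with ω h1 h2 x₀ x
  obtain ⟨m, hm⟩ : ∃ m, N₀ + 1 = N ω + m := ⟨N₀ + 1 - N ω, by omega⟩
  obtain ⟨z, hz⟩ := fiberIter_surjective hT.surjective_map m (θ^[N ω] ω) x
  obtain ⟨y, hy, hyz⟩ : z ∈ fiberIter θ T (N ω) ω '' Metric.ball x₀ ξ := by
    rw [h1 x₀]; exact Set.mem_univ z
  refine ⟨y, by rwa [dist_comm], ?_⟩
  rw [hm, fiberIter_add, hyz, hz]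

variable [CompactSpace X] [Nonempty X] [IsProbabilityMeasure P]

theorem StandingAssumptions.exists_regularFiber {θ : Ω ≃ᵐ Ω} (hθ : MeasurePreserving θ P P)
    {T : Ω → X → X} {φ u : Ω → X → ℝ} {α ξ : ℝ} (hT : StandingAssumptions P θ T φ u α ξ)
    {lam : Ω → ℝ} {h : Ω → X → ℝ} {ν : Kernel Ω X}
    (hRPF : IsRPFTriplet P θ T φ α ξ lam h ν) :
    ∃ (c D H U Q K : ℝ) (N : ℕ), 0 < c ∧ c < 1 ∧ 1 ≤ D ∧ 0 ≤ H ∧ 0 ≤ U ∧ 0 ≤ Q ∧ 1 ≤ K ∧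
      0 < N ∧ ∀ᵐ ω ∂P, ∀ n, RegularFiber θ T φ u h lam ν α ξ c D H U Q K N (θ^[n] ω) := by
  have hα := hT.alpha_pos
  have hξ := hT.xi_pos
  obtain ⟨c, D, H, hc0, hc1, hD, hH, hreg⟩ := hT.exists_regularMap
  obtain ⟨N, hN, hex⟩ := hT.exists_covering_time
  obtain ⟨Q, hQ, hlog⟩ := exists_ae_logHolder_of_eigenfunction hθ hα hξ hc0.le hc1 hH hreg
    hRPF.measurable_eigenfunction hRPF.eigenvalue_pos hRPF.eigenfunction_pos
    hRPF.eigenfunction_holder hRPF.eigenfunction_eq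
  obtain ⟨C, hC⟩ := hT.observable_bounded
  set K := (D * Real.exp H) ^ N * Real.exp H ^ N * Real.exp (Q * ξ ^ α) with hK
  have hexp : 1 ≤ Real.exp H := Real.one_le_exp hH
  have hK1 : 1 ≤ K := one_le_mul_of_one_le_of_one_le (one_le_mul_of_one_le_of_one_le
    (one_le_pow₀ (one_le_mul_of_one_le_of_one_le hD hexp)) (one_le_pow₀ hexp))
    (Real.one_le_exp (by positivity))
  have hratio : ∀ᵐ ω ∂P, ∀ x x', h ω x ≤ K * h ω x' := by
    have h1 : ∀ᵐ ω ∂P, ∀ x x', h (θ^[N] ω) x ≤ K * h (θ^[N] ω) x' := by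
      filter_upwards [ae_forall_iterate hθ hreg, ae_forall_iterate hθ hRPF.eigenvalue_pos,
        ae_forall_iterate hθ hlog, ae_forall_iterate hθ hRPF.eigenfunction_eq, hex]
        with ω h1 h2 h3 h4 h5
      refine eigenfunction_ratio_le hα hξ (by linarith) hQ h1 h2 h3 (fun n x => ?_) h5
      rw [Function.iterate_succ_apply']
      exact h4 n x
    -- The comparison holds at the end `θ^N ω` of the covering time; invertibility of `θ` transports
    -- it back to almost every `ω`.
    have h2 := ((hθ.symm θ).iterate N).quasiMeasurePreserving.ae h1
    filter_upwards [h2] with ω hω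
    have h3 : θ^[N] (θ.symm^[N] ω) = ω :=
      Function.LeftInverse.iterate (f := θ.symm) (g := θ) θ.apply_symm_apply N ω
    rwa [h3] at hω
  refine ⟨c, D, H, (C + 1 : ℝ≥0), Q, K, N, hc0, hc1, hD, hH, NNReal.coe_nonneg _, hQ, hK1, hN,
    ae_forall_iterate hθ ?_⟩
  filter_upwards [hreg, hC, hRPF.eigenvalue_pos, hlog, hratio, hRPF.eigenfunction_eq,
    hRPF.conformal, hRPF.normalized, hex] with ω h1 h2 h3 h4 h5 h6 h7 h8 h9
  obtain ⟨h10, h11⟩ := exists_bound_of_holderNorm_lt (C := C + 1) (lt_of_le_of_lt h2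
    (by exact_mod_cast lt_add_one C))
  exact ⟨h1, h10, h11, h3, h4, h5, h6, h7, h8, h9⟩

end Regularity

/-! ### Exponential decay of correlations -/

section Integrals

variable {X : Type*} [MeasurableSpace X]

theorem abs_integral_le_of_abs_le {μ : Measure X} [IsProbabilityMeasure μ] {g : X → ℝ} {C : ℝ}
    (hg : ∀ x, |g x| ≤ C) : |∫ x, g x ∂μ| ≤ C := by
  have := norm_integral_le_of_norm_le_const (μ := μ) (f := g) (C := C)
    (Eventually.of_forall hg)
  simpa using this

variable [MetricSpace X] [CompactSpace X] [BorelSpace X]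

theorem integrable_of_continuous {μ : Measure X} [IsFiniteMeasure μ] {g : X → ℝ}
    (hg : Continuous g) : Integrable g μ :=
  hg.integrable_of_hasCompactSupport (HasCompactSupport.of_compactSpace _)

/-- Bound for the covariance of two functions one of which oscillates little. -/
theorem abs_covariance_le {μ : Measure X} [IsProbabilityMeasure μ] {F g : X → ℝ} {a e U : ℝ}
    (hF : Continuous F) (hg : Continuous g) (hFa : ∀ x, F x ∈ Set.Icc a (a + e))
    (hgU : ∀ x, |g x| ≤ U) :
    |∫ x, F x * g x ∂μ - (∫ x, F x ∂μ) * ∫ x, g x ∂μ| ≤ 2 * (e * U) := by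
  have hFe : ∀ x, |F x - a| ≤ e := fun x => by
    rw [abs_of_nonneg (by linarith [(hFa x).1])]
    linarith [(hFa x).2]
  have h1 : ∫ x, (F x - a) * g x ∂μ = ∫ x, F x * g x ∂μ - a * ∫ x, g x ∂μ := by
    have hi1 : Integrable (fun x => F x * g x) μ := integrable_of_continuous (hF.mul hg)
    have hi2 : Integrable (fun x => a * g x) μ :=
      integrable_of_continuous (continuous_const.mul hg)
    rw [← integral_const_mul, ← integral_sub hi1 hi2]
    exact integral_congr_ae (Eventually.of_forall fun x => by ring)
  have h2 : ∫ x, (F x - a) ∂μ = ∫ x, F x ∂μ - a := by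
    rw [integral_sub (integrable_of_continuous hF) (integrable_const a)]
    simp
  have h3 : ∫ x, F x * g x ∂μ - (∫ x, F x ∂μ) * ∫ x, g x ∂μ =
      ∫ x, (F x - a) * g x ∂μ - (∫ x, (F x - a) ∂μ) * ∫ x, g x ∂μ := by
    rw [h1, h2]; ring
  have h4 : |∫ x, (F x - a) * g x ∂μ| ≤ e * U := abs_integral_le_of_abs_le fun x => by
    rw [abs_mul]
    exact mul_le_mul (hFe x) (hgU x) (abs_nonneg _) ((abs_nonneg _).trans (hFe x))
  have h5 : |(∫ x, (F x - a) ∂μ) * ∫ x, g x ∂μ| ≤ e * U := by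
    rw [abs_mul]
    have h6 := abs_integral_le_of_abs_le (μ := μ) hFe
    exact mul_le_mul h6 (abs_integral_le_of_abs_le hgU) (abs_nonneg _) ((abs_nonneg _).trans h6)
  rw [h3]
  refine (abs_sub _ _).trans ?_
  linarith

end Integrals

section Covariance

variable {Ω X : Type*} [MetricSpace X] [MeasurableSpace X]

/-- A uniformly contracting family `A_ω` together with fiber measures `μ_ω` for which `A_ω` is
the dual of the composition with `T_ω`. -/
structure DualContraction (θ : Ω → Ω) (T : Ω → X → X) (A : Ω → (X → ℝ) → X → ℝ)
    (μ : Ω → Measure X) (good : Set Ω) (α ξ s B p : ℝ) (N : ℕ) : Prop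
    extends UniformlyContracting θ T A good α ξ s B p N where
  continuous_map : ∀ ω, Continuous (T ω)
  isProbabilityMeasure : ∀ ω ∈ good, IsProbabilityMeasure (μ ω)
  dual : ∀ ω ∈ good, ∀ F g : X → ℝ, Continuous F → Continuous g →
    ∫ x, F x * g (T ω x) ∂(μ ω) = ∫ x, A ω F x * g x ∂(μ (θ ω))

namespace DualContraction

variable {θ : Ω → Ω} {T : Ω → X → X} {A : Ω → (X → ℝ) → X → ℝ} {μ : Ω → Measure X}
  {good : Set Ω} {α ξ s B p : ℝ} {N : ℕ}

theorem integral_comp_fiberIter (hA : DualContraction θ T A μ good α ξ s B p N) {ω : Ω}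
    (hω : ω ∈ good) {g : X → ℝ} (hg : Continuous g) (n : ℕ) :
    ∫ x, g (fiberIter θ T n ω x) ∂(μ ω) = ∫ x, g x ∂(μ (θ^[n] ω)) := by
  induction n generalizing g with
  | zero => rfl
  | succ n ih =>
    have h1 := ih (hg.comp (hA.continuous_map (θ^[n] ω)))
    simp only [Function.comp_apply] at h1
    have hn := hA.shift_iterate hω n
    have h2 := hA.dual _ hn (fun _ => 1) g continuous_const hg
    simp only [hA.const _ hn, one_mul] at h2
    rw [Function.iterate_succ_apply', ← h2, ← h1]
    rfl

theorem integral_mul_comp_fiberIter (hA : DualContraction θ T A μ good α ξ s B p N) {ω : Ω}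
    (hω : ω ∈ good) {Q : ℝ} (hQ0 : 0 ≤ Q) (hQ : s * (Q + B) ≤ Q) {F g : X → ℝ}
    (hF : LogHolder α ξ Q F) (hg : Continuous g) (n : ℕ) :
    ∫ x, F x * g (fiberIter θ T n ω x) ∂(μ ω) =
      ∫ x, opIter θ A n ω F x * g x ∂(μ (θ^[n] ω)) := by
  induction n generalizing g with
  | zero => rfl
  | succ n ih =>
    have h1 := ih (hg.comp (hA.continuous_map (θ^[n] ω)))
    simp only [Function.comp_apply] at h1
    have h2 := hA.dual _ (hA.shift_iterate hω n) (opIter θ A n ω F) g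
      ((hA.opIter_logHolder hω hQ0 hQ hF n).continuous hA.alpha_pos hA.xi_pos) hg
    rw [Function.iterate_succ_apply']
    exact h1.trans h2

/-- Exponential decay of correlations, uniformly over the good parameters. -/
theorem exists_covariance_decay [CompactSpace X] [BorelSpace X] [Nonempty X]
    (hA : DualContraction θ T A μ good α ξ s B p N)
    {U : ℝ} (hU : 0 ≤ U) :
    ∃ C t : ℝ, 0 ≤ C ∧ 0 < t ∧ t < 1 ∧ ∀ (n : ℕ), ∀ ω ∈ good, ∀ f g : X → ℝ,
      (∀ x, |f x| ≤ U) → (∀ x x', dist x x' < ξ → |f x - f x'| ≤ U * dist x x' ^ α) →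
      Continuous g → (∀ x, |g x| ≤ U) →
      |∫ x, f x * g (fiberIter θ T n ω x) ∂(μ ω) -
        (∫ x, f x ∂(μ ω)) * ∫ x, g x ∂(μ (θ^[n] ω))| ≤ C * t ^ n := by
  obtain ⟨Q, C, t, hQ0, hQ, hC, ht0, ht1, hosc⟩ := hA.exists_oscillation_decay
  -- Shifting by `a` gives `f + a ≥ (U + 1) / Q`, so the logarithmic Hölder constant is at most `U Q
  -- / (U + 1) ≤ Q`. Covariances are unaffected by the shift.
  set a := U + (U + 1) / Q with ha
  have hUQ : 0 < (U + 1) / Q := by positivity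
  refine ⟨2 * (C * (U + a) * U), t, by positivity, ht0, ht1, ?_⟩
  intro n ω hω f g hfU hfH hg hgU
  have hαp := hA.alpha_pos
  have hξp := hA.xi_pos
  have hfc : Continuous f := continuous_of_locally_holder hαp hξp hfH
  have hF : LogHolder α ξ Q (fun x => f x + a) := by
    have h1 : LogHolder α ξ (U / ((U + 1) / Q)) (fun x => f x + a) := by
      refine LogHolder.of_lower_bound hUQ hU (fun x => ?_) (fun x x' hx => ?_)
      · have := neg_le_of_abs_le (hfU x)
        linarith
      · rw [add_sub_add_right_eq_sub]
        exact hfH x x' hx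
    refine h1.mono ?_
    rw [div_div_eq_mul_div, div_le_iff₀ (by linarith)]
    nlinarith
  have hFG : ∀ x, f x + a ≤ U + a := fun x => by linarith [(abs_le.1 (hfU x)).2]
  obtain ⟨b, hb⟩ := hosc n ω hω _ _ hF hFG
  have hFn := hA.opIter_logHolder hω hQ0.le hQ hF n
  have := hA.isProbabilityMeasure ω hω
  have := hA.isProbabilityMeasure _ (hA.shift_iterate hω n)
  have h1 := abs_covariance_le (μ := μ (θ^[n] ω)) (hFn.continuous hαp hξp) hg hb hgU
  have h2 := hA.integral_mul_comp_fiberIter hω hQ0.le hQ hF hg n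
  have h3 := hA.integral_mul_comp_fiberIter hω hQ0.le hQ hF
    (continuous_const (y := (1 : ℝ))) n
  simp only [mul_one] at h3
  rw [← h2, ← h3] at h1
  have hgc : Continuous fun x => g (fiberIter θ T n ω x) :=
    hg.comp (fiberIter_continuous hA.continuous_map n ω)
  have h4 : ∫ x, (f x + a) * g (fiberIter θ T n ω x) ∂(μ ω) =
      ∫ x, f x * g (fiberIter θ T n ω x) ∂(μ ω) + a * ∫ x, g x ∂(μ (θ^[n] ω)) := by
    have hi1 : Integrable (fun x => f x * g (fiberIter θ T n ω x)) (μ ω) :=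
      integrable_of_continuous (hfc.mul hgc)
    have hi2 : Integrable (fun x => a * g (fiberIter θ T n ω x)) (μ ω) :=
      integrable_of_continuous (continuous_const.mul hgc)
    rw [← hA.integral_comp_fiberIter hω hg n, ← integral_const_mul, ← integral_add hi1 hi2]
    exact integral_congr_ae (Eventually.of_forall fun x => by ring)
  have h5 : ∫ x, (f x + a) ∂(μ ω) = ∫ x, f x ∂(μ ω) + a := by
    rw [integral_add (integrable_of_continuous hfc) (integrable_const a)]
    simp
  rw [h4, h5] at h1
  refine le_trans (le_of_eq ?_) (h1.trans_eq ?_)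
  · congr 1; ring
  · ring

end DualContraction

end Covariance

/-! ### Quasi-additivity of the variances -/

section QuasiAdditivity

variable {Ω X : Type*}

theorem fiberSum_add (θ : Ω → Ω) (T : Ω → X → X) (ψ : Ω → X → ℝ) (a b : ℕ) (ω : Ω) (x : X) :
    fiberSum θ T ψ (a + b) ω x =
      fiberSum θ T ψ a ω x + fiberSum θ T ψ b (θ^[a] ω) (fiberIter θ T a ω x) := by
  unfold fiberSum
  rw [Finset.sum_range_add]
  congr 1
  refine Finset.sum_congr rfl fun j _ => ?_
  rw [fiberIter_add, ← Function.iterate_add_apply, add_comm a j]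

theorem abs_fiberSum_le {θ : Ω → Ω} {T : Ω → X → X} {ψ : Ω → X → ℝ} {U : ℝ} {ω : Ω}
    (hψ : ∀ n x, |ψ (θ^[n] ω) x| ≤ U) (n : ℕ) (x : X) : |fiberSum θ T ψ n ω x| ≤ n * U := by
  unfold fiberSum
  refine (Finset.abs_sum_le_sum_abs _ _).trans ?_
  refine (Finset.sum_le_sum fun j _ => hψ j _).trans_eq ?_
  simp

/-- The exponent is the time gap between step `i` of the first block and step `j` of the second; the
sum factors into two geometric ones, with a bound free of `a` and `b`. -/
theorem sum_sum_pow_le {t : ℝ} (ht0 : 0 ≤ t) (ht1 : t < 1) (a b : ℕ) :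
    ∑ i ∈ Finset.range a, ∑ j ∈ Finset.range b, t ^ (a - i + j) ≤ (1 - t)⁻¹ * (1 - t)⁻¹ := by
  have hgeom : ∀ n : ℕ, ∑ j ∈ Finset.range n, t ^ j ≤ (1 - t)⁻¹ := fun n => by
    rw [← tsum_geometric_of_lt_one ht0 ht1]
    exact (summable_geometric_of_lt_one ht0 ht1).sum_le_tsum _ fun _ _ => pow_nonneg ht0 _
  have h1 : ∑ i ∈ Finset.range a, t ^ (a - i) ≤ (1 - t)⁻¹ := by
    rw [← Finset.sum_range_reflect]
    refine le_trans (Finset.sum_le_sum fun i hi => ?_) (hgeom a)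
    have := Finset.mem_range.1 hi
    exact pow_le_pow_of_le_one ht0 ht1.le (by omega)
  have h2 : ∑ i ∈ Finset.range a, ∑ j ∈ Finset.range b, t ^ (a - i + j) =
      (∑ i ∈ Finset.range a, t ^ (a - i)) * ∑ j ∈ Finset.range b, t ^ j := by
    rw [Finset.sum_mul_sum]
    simp only [pow_add]
  rw [h2]
  exact mul_le_mul h1 (hgeom b) (Finset.sum_nonneg fun _ _ => pow_nonneg ht0 _)
    (inv_nonneg.2 (by linarith))

variable [MetricSpace X] [MeasurableSpace X] {θ : Ω → Ω} {T : Ω → X → X}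
  {A : Ω → (X → ℝ) → X → ℝ} {μ : Ω → Measure X} {good : Set Ω} {α ξ s B p : ℝ} {N : ℕ}

theorem DualContraction.continuous_fiberSum (hA : DualContraction θ T A μ good α ξ s B p N)
    {ψ : Ω → X → ℝ} (hψ : ∀ ω ∈ good, Continuous (ψ ω)) {ω : Ω} (hω : ω ∈ good) (n : ℕ) :
    Continuous (fiberSum θ T ψ n ω) := by
  unfold fiberSum
  exact continuous_finsetSum _ fun j _ =>
    (hψ _ (hA.shift_iterate hω j)).comp (fiberIter_continuous hA.continuous_map j ω)

variable [CompactSpace X] [BorelSpace X]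

/-- The second moments of the fiber sums of a centered observable are additive along the orbit up
to a uniformly bounded error. -/
theorem DualContraction.exists_quasi_additive [Nonempty X]
    (hA : DualContraction θ T A μ good α ξ s B p N) {ψ : Ω → X → ℝ} {U : ℝ} (hU : 0 ≤ U)
    (hψU : ∀ ω ∈ good, ∀ x, |ψ ω x| ≤ U)
    (hψH : ∀ ω ∈ good, ∀ x x', dist x x' < ξ → |ψ ω x - ψ ω x'| ≤ U * dist x x' ^ α)
    (hψ0 : ∀ ω ∈ good, ∫ x, ψ ω x ∂(μ ω) = 0) :
    ∃ C : ℝ, 0 ≤ C ∧ ∀ ω ∈ good, ∀ a b : ℕ,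
      |∫ x, fiberSum θ T ψ (a + b) ω x ^ 2 ∂(μ ω) - ∫ x, fiberSum θ T ψ a ω x ^ 2 ∂(μ ω) -
        ∫ x, fiberSum θ T ψ b (θ^[a] ω) x ^ 2 ∂(μ (θ^[a] ω))| ≤ C := by
  obtain ⟨C, t, hC, ht0, ht1, hcov⟩ := hA.exists_covariance_decay hU
  have hψc : ∀ ω ∈ good, Continuous (ψ ω) := fun ω hω =>
    continuous_of_locally_holder hA.alpha_pos hA.xi_pos (hψH ω hω)
  have hit := fun n ω => fiberIter_continuous (θ := θ) hA.continuous_map n ω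
  have ht' : 0 < (1 - t)⁻¹ := inv_pos.2 (by linarith)
  refine ⟨2 * (C * ((1 - t)⁻¹ * (1 - t)⁻¹)), by positivity, fun ω hω a b => ?_⟩
  have := hA.isProbabilityMeasure ω hω
  have hωa := hA.shift_iterate hω a
  have hSa := hA.continuous_fiberSum hψc hω a
  have hSb := hA.continuous_fiberSum hψc hωa b
  have hSb' : Continuous fun x => fiberSum θ T ψ b (θ^[a] ω) (fiberIter θ T a ω x) :=
    hSb.comp (hit a ω)
  -- Equivariance of the fiber measures removes the first `i` steps and leaves a correlation over
  -- time `a - i + j`, whose product of means vanishes by centering.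
  have hpair : ∀ i < a, ∀ j : ℕ, |∫ x, ψ (θ^[i] ω) (fiberIter θ T i ω x) *
      ψ (θ^[j] (θ^[a] ω)) (fiberIter θ T j (θ^[a] ω) (fiberIter θ T a ω x)) ∂(μ ω)| ≤
      C * t ^ (a - i + j) := by
    intro i hi j
    have hωi := hA.shift_iterate hω i
    have hθ' : θ^[a - i + j] (θ^[i] ω) = θ^[j] (θ^[a] ω) := by
      rw [← Function.iterate_add_apply, ← Function.iterate_add_apply,
        show a - i + j + i = j + a by omega]
    have hωj : θ^[j] (θ^[a] ω) ∈ good := hA.shift_iterate hωa j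
    have h1 : ∀ x, fiberIter θ T j (θ^[a] ω) (fiberIter θ T a ω x) =
        fiberIter θ T (a - i + j) (θ^[i] ω) (fiberIter θ T i ω x) := by
      intro x
      rw [← fiberIter_add, ← fiberIter_add, show i + (a - i + j) = a + j by omega]
    simp only [h1]
    have h2 := hA.integral_comp_fiberIter hω (g := fun x => ψ (θ^[i] ω) x *
      ψ (θ^[j] (θ^[a] ω)) (fiberIter θ T (a - i + j) (θ^[i] ω) x))
      ((hψc _ hωi).mul ((hψc _ hωj).comp (hit _ _))) i
    rw [h2]
    have h3 := hcov (a - i + j) _ hωi (ψ (θ^[i] ω)) (ψ (θ^[j] (θ^[a] ω))) (hψU _ hωi)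
      (hψH _ hωi) (hψc _ hωj) (hψU _ hωj)
    rwa [hψ0 _ hωi, zero_mul, sub_zero] at h3
  have hcross : |∫ x, fiberSum θ T ψ a ω x *
      fiberSum θ T ψ b (θ^[a] ω) (fiberIter θ T a ω x) ∂(μ ω)| ≤
      C * ((1 - t)⁻¹ * (1 - t)⁻¹) := by
    have h1 : ∫ x, fiberSum θ T ψ a ω x *
        fiberSum θ T ψ b (θ^[a] ω) (fiberIter θ T a ω x) ∂(μ ω) =
        ∑ i ∈ Finset.range a, ∑ j ∈ Finset.range b, ∫ x, ψ (θ^[i] ω) (fiberIter θ T i ω x) *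
          ψ (θ^[j] (θ^[a] ω)) (fiberIter θ T j (θ^[a] ω) (fiberIter θ T a ω x)) ∂(μ ω) := by
      have hint : ∀ i j, Integrable (fun x => ψ (θ^[i] ω) (fiberIter θ T i ω x) *
          ψ (θ^[j] (θ^[a] ω)) (fiberIter θ T j (θ^[a] ω) (fiberIter θ T a ω x))) (μ ω) :=
        fun i j => integrable_of_continuous
          (((hψc _ (hA.shift_iterate hω i)).comp (hit i ω)).mul
            ((hψc _ (hA.shift_iterate hωa j)).comp ((hit _ _).comp (hit a ω))))
      simp only [fiberSum, Finset.sum_mul_sum]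
      rw [integral_finsetSum _ fun i _ => integrable_finsetSum _ fun j _ => hint i j]
      exact Finset.sum_congr rfl fun i _ => integral_finsetSum _ fun j _ => hint i j
    rw [h1]
    refine le_trans ?_ (mul_le_mul_of_nonneg_left (sum_sum_pow_le ht0.le ht1 a b) hC)
    rw [Finset.mul_sum]
    refine (Finset.abs_sum_le_sum_abs _ _).trans (Finset.sum_le_sum fun i hi => ?_)
    rw [Finset.mul_sum]
    refine (Finset.abs_sum_le_sum_abs _ _).trans (Finset.sum_le_sum fun j _ => ?_)
    exact hpair i (Finset.mem_range.1 hi) j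
  have hsq : ∫ x, fiberSum θ T ψ (a + b) ω x ^ 2 ∂(μ ω) =
      ∫ x, fiberSum θ T ψ a ω x ^ 2 ∂(μ ω) +
        ∫ x, fiberSum θ T ψ b (θ^[a] ω) x ^ 2 ∂(μ (θ^[a] ω)) +
      2 * ∫ x, fiberSum θ T ψ a ω x *
        fiberSum θ T ψ b (θ^[a] ω) (fiberIter θ T a ω x) ∂(μ ω) := by
    have h1 := hA.integral_comp_fiberIter hω (g := fun x => fiberSum θ T ψ b (θ^[a] ω) x ^ 2)
      (hSb.pow 2) a
    have hi1 : Integrable (fun x => fiberSum θ T ψ a ω x ^ 2) (μ ω) :=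
      integrable_of_continuous (hSa.pow 2)
    have hi2 : Integrable
        (fun x => fiberSum θ T ψ b (θ^[a] ω) (fiberIter θ T a ω x) ^ 2) (μ ω) :=
      integrable_of_continuous (hSb'.pow 2)
    have hi3 : Integrable (fun x => 2 * (fiberSum θ T ψ a ω x *
        fiberSum θ T ψ b (θ^[a] ω) (fiberIter θ T a ω x))) (μ ω) :=
      integrable_of_continuous (continuous_const.mul (hSa.mul hSb'))
    rw [← h1, ← integral_const_mul, ← integral_add hi1 hi2,
      ← integral_add (by exact hi1.add hi2) hi3]
    refine integral_congr_ae (Eventually.of_forall fun x => ?_)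
    simp only [fiberSum_add]
    ring
  rw [hsq, add_assoc, add_sub_cancel_left, add_sub_cancel_left, abs_mul, abs_two]
  linarith

/-- The fiber variance is the second moment of the fiber sum of the centered observable. -/
theorem DualContraction.fiberVariance_eq (hA : DualContraction θ T A μ good α ξ s B p N)
    {u : Ω → X → ℝ} (hu : ∀ ω ∈ good, Continuous (u ω)) {ω : Ω} (hω : ω ∈ good) (n : ℕ) :
    fiberVariance θ T u μ n ω = ∫ x, fiberSum θ T (centered μ u) n ω x ^ 2 ∂(μ ω) := by
  have := hA.isProbabilityMeasure ω hω
  have hc := hA.continuous_fiberSum hu hω n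
  have h1 : ∫ x, fiberSum θ T u n ω x ∂(μ ω) =
      ∑ j ∈ Finset.range n, ∫ x, u (θ^[j] ω) x ∂(μ (θ^[j] ω)) := by
    have hint : ∀ j, Integrable (fun x => u (θ^[j] ω) (fiberIter θ T j ω x)) (μ ω) := fun j =>
      integrable_of_continuous
        ((hu _ (hA.shift_iterate hω j)).comp (fiberIter_continuous hA.continuous_map j ω))
    unfold fiberSum
    rw [integral_finsetSum _ fun j _ => hint j]
    exact Finset.sum_congr rfl fun j _ =>
      hA.integral_comp_fiberIter hω (hu _ (hA.shift_iterate hω j)) j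
  unfold fiberVariance
  rw [variance_eq_integral hc.measurable.aemeasurable, h1]
  refine integral_congr_ae (Eventually.of_forall fun x => ?_)
  simp only [fiberSum, centered, Finset.sum_sub_distrib]

end QuasiAdditivity

/-! ### Maximal ergodic inequality and deviation bounds -/

section Deviations

variable {Ω : Type*}

/-- The maximum of the Birkhoff sums of `f` of lengths `0, …, n`. -/
noncomputable def maxBirkhoffSum (τ : Ω → Ω) (f : Ω → ℝ) : ℕ → Ω → ℝ
  | 0, _ => 0
  | n + 1, ω => max 0 (f ω + maxBirkhoffSum τ f n (τ ω))

theorem maxBirkhoffSum_nonneg (τ : Ω → Ω) (f : Ω → ℝ) (n : ℕ) (ω : Ω) :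
    0 ≤ maxBirkhoffSum τ f n ω := by
  cases n with
  | zero => exact le_rfl
  | succ n => exact le_max_left _ _

theorem maxBirkhoffSum_le_succ (τ : Ω → Ω) (f : Ω → ℝ) (n : ℕ) (ω : Ω) :
    maxBirkhoffSum τ f n ω ≤ maxBirkhoffSum τ f (n + 1) ω := by
  induction n generalizing ω with
  | zero => exact maxBirkhoffSum_nonneg τ f _ ω
  | succ n ih => exact max_le_max le_rfl (add_le_add_right (ih (τ ω)) _)

theorem birkhoffSum_le_maxBirkhoffSum (τ : Ω → Ω) (f : Ω → ℝ) (n : ℕ) (ω : Ω) :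
    birkhoffSum τ f n ω ≤ maxBirkhoffSum τ f n ω := by
  induction n generalizing ω with
  | zero => simp [maxBirkhoffSum]
  | succ n ih =>
    rw [birkhoffSum_succ', maxBirkhoffSum]
    exact le_max_of_le_right (add_le_add_right (ih (τ ω)) _)

variable [MeasurableSpace Ω] {P : Measure Ω}

theorem measurable_maxBirkhoffSum {τ : Ω → Ω} (hτ : Measurable τ) {f : Ω → ℝ}
    (hf : Measurable f) (n : ℕ) : Measurable (maxBirkhoffSum τ f n) := by
  induction n with
  | zero => exact measurable_const
  | succ n ih => exact measurable_const.max (hf.add (ih.comp hτ))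

theorem integrable_maxBirkhoffSum [IsFiniteMeasure P] {τ : Ω → Ω} (hτ : MeasurePreserving τ P P)
    {f : Ω → ℝ} (hf : Integrable f P) (n : ℕ) : Integrable (maxBirkhoffSum τ f n) P := by
  induction n with
  | zero => exact integrable_zero _ _ _
  | succ n ih => exact (integrable_const 0).sup (hf.add (hτ.integrable_comp_of_integrable ih))

/-- The maximal ergodic inequality. -/
theorem setIntegral_nonneg_of_maxBirkhoffSum_pos [IsFiniteMeasure P] {τ : Ω → Ω}
    (hτ : MeasurePreserving τ P P) {f : Ω → ℝ} (hfm : Measurable f) (hf : Integrable f P)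
    (n : ℕ) : 0 ≤ ∫ ω in {ω | 0 < maxBirkhoffSum τ f n ω}, f ω ∂P := by
  cases n with
  | zero => simp [maxBirkhoffSum]
  | succ n =>
    have hM := integrable_maxBirkhoffSum hτ hf (n + 1)
    have hMτ : Integrable (fun ω => maxBirkhoffSum τ f (n + 1) (τ ω)) P :=
      hτ.integrable_comp_of_integrable hM
    have hE : MeasurableSet {ω | 0 < maxBirkhoffSum τ f (n + 1) ω} :=
      measurableSet_lt measurable_const (measurable_maxBirkhoffSum hτ.measurable hfm _)
    rw [← integral_indicator hE]
    have h1 : ∫ ω, (maxBirkhoffSum τ f (n + 1) ω - maxBirkhoffSum τ f (n + 1) (τ ω)) ∂P = 0 := by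
      rw [integral_sub hM hMτ]
      have h2 := integral_map (μ := P) hτ.measurable.aemeasurable
        (f := maxBirkhoffSum τ f (n + 1)) (by rw [hτ.map_eq]; exact hM.aestronglyMeasurable)
      rw [hτ.map_eq] at h2
      rw [← h2, sub_self]
    refine h1.symm.le.trans ?_
    -- Garsia's argument: where the maximum is positive, `f` equals it minus the shorter maximum at
    -- `τ ω`; elsewhere the maximum is zero and the difference is nonpositive.
    refine integral_mono (hM.sub hMτ) (hf.indicator hE) fun ω => ?_
    by_cases hω : 0 < maxBirkhoffSum τ f (n + 1) ω
    · have h2 : maxBirkhoffSum τ f (n + 1) ω = f ω + maxBirkhoffSum τ f n (τ ω) := by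
        rw [maxBirkhoffSum] at hω ⊢
        exact max_eq_right (by
          by_contra hneg
          rw [max_eq_left (not_le.1 hneg).le] at hω
          exact lt_irrefl _ hω)
      have h3 := maxBirkhoffSum_le_succ τ f n (τ ω)
      rw [Set.indicator_of_mem (by exact hω)]
      linarith
    · rw [Set.indicator_of_notMem (by exact hω)]
      have h2 := maxBirkhoffSum_nonneg τ f (n + 1) (τ ω)
      linarith [not_lt.1 hω]

/-- If the Birkhoff sums of `g - a` become positive on a set `R`, then `∫ g ≥ a P(R)`, for
nonnegative `g`. -/
theorem mul_measureReal_le_integral [IsFiniteMeasure P] {τ : Ω → Ω}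
    (hτ : MeasurePreserving τ P P) {g : Ω → ℝ} (hgm : Measurable g) (hg : Integrable g P)
    (hg0 : 0 ≤ᵐ[P] g) {a : ℝ} (ha : 0 ≤ a) {R : Set Ω}
    (hR : ∀ᵐ ω ∂P, ω ∈ R → ∃ n, 0 < birkhoffSum τ (fun ω => g ω - a) n ω) :
    a * P.real R ≤ ∫ ω, g ω ∂P := by
  set f : Ω → ℝ := fun ω => g ω - a with hf
  have hfm : Measurable f := hgm.sub_const a
  have hfi : Integrable f P := hg.sub (integrable_const a)
  set E : ℕ → Set Ω := fun n => {ω | 0 < maxBirkhoffSum τ f n ω} with hE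
  have hEm : ∀ n, MeasurableSet (E n) := fun n =>
    measurableSet_lt measurable_const (measurable_maxBirkhoffSum hτ.measurable hfm n)
  have hmono : Monotone E := monotone_nat_of_le_succ fun n ω hω =>
    lt_of_lt_of_le hω (maxBirkhoffSum_le_succ τ f n ω)
  have h1 : ∀ n, a * P.real (E n) ≤ ∫ ω, g ω ∂P := by
    intro n
    have h2 := setIntegral_nonneg_of_maxBirkhoffSum_pos hτ hfm hfi n
    have h3 : ∫ ω in E n, f ω ∂P = ∫ ω in E n, g ω ∂P - a * P.real (E n) := by
      rw [hf, integral_sub hg.integrableOn (integrable_const a)]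
      simp [mul_comm]
    have h4 : ∫ ω in E n, g ω ∂P ≤ ∫ ω, g ω ∂P := setIntegral_le_integral hg hg0
    linarith
  have h5 : Tendsto (fun n => P.real (E n)) atTop (𝓝 (P.real (⋃ n, E n))) :=
    (ENNReal.tendsto_toReal (measure_ne_top P _)).comp (tendsto_measure_iUnion_atTop hmono)
  have h6 : P.real R ≤ P.real (⋃ n, E n) := by
    refine ENNReal.toReal_mono (measure_ne_top P _) (measure_mono_ae ?_)
    filter_upwards [hR] with ω hω hωR
    obtain ⟨n, hn⟩ := hω hωR
    exact Set.mem_iUnion.2 ⟨n, hn.trans_le (birkhoffSum_le_maxBirkhoffSum τ f n ω)⟩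
  exact (mul_le_mul_of_nonneg_left h6 ha).trans
    (le_of_tendsto (h5.const_mul a) (Eventually.of_forall h1))

/-- `V` is additive along the orbit of `ω`, up to an error `C`. -/
def QuasiAdditiveAt (θ : Ω → Ω) (V : ℕ → Ω → ℝ) (C : ℝ) (ω : Ω) : Prop :=
  ∀ a b : ℕ, |V (a + b) ω - V a ω - V b (θ^[a] ω)| ≤ C

/-- The error is `C` per block, whatever the block length, so long blocks make it small relative to
time. -/
theorem QuasiAdditiveAt.abs_sub_sum_le {Ω : Type*} {θ : Ω → Ω} {V : ℕ → Ω → ℝ} {C : ℝ} {ω : Ω}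
    (h : QuasiAdditiveAt θ V C ω) (h0 : V 0 ω = 0) (k n : ℕ) :
    |V (n * k) ω - ∑ j ∈ Finset.range n, V k (θ^[j * k] ω)| ≤ C * n := by
  induction n with
  | zero => simp [h0]
  | succ n ih =>
    have h1 := h (n * k) k
    rw [Finset.sum_range_succ, add_mul, one_mul]
    have h2 := abs_add_le (V (n * k + k) ω - V (n * k) ω - V k (θ^[n * k] ω))
      (V (n * k) ω - ∑ j ∈ Finset.range n, V k (θ^[j * k] ω))
    have h3 : V (n * k + k) ω - (∑ j ∈ Finset.range n, V k (θ^[j * k] ω) + V k (θ^[n * k] ω)) =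
      (V (n * k + k) ω - V (n * k) ω - V k (θ^[n * k] ω)) +
        (V (n * k) ω - ∑ j ∈ Finset.range n, V k (θ^[j * k] ω)) := by ring
    rw [h3]
    push_cast
    linarith

/-- A lower deviation bound for block variances, comparable to `V`, gives variance growth. -/
theorem BlockLowerDeviation.varianceGrowth [IsProbabilityMeasure P] {θ : Ω → Ω}
    (hθ : MeasurePreserving θ P P) {V W : ℕ → Ω → ℝ} {β C m : ℝ} (hβ : 0 < β) (hC : 0 ≤ C)
    (hm : 0 < m) (hV0 : ∀ n ω, 0 ≤ V n ω) (hVz : ∀ ω, V 0 ω = 0)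
    (hadd : ∀ᵐ ω ∂P, QuasiAdditiveAt θ V C ω) (hVW : ∀ᵐ ω ∂P, ∀ k, m * W k ω ≤ V k ω)
    (hW : BlockLowerDeviation P θ W β) : VarianceGrowth P V β := by
  obtain ⟨d₁, d₂, hd₁, hdev⟩ := hW
  obtain ⟨k₀, hk₀⟩ := exists_nat_ge (4 * C / (m * d₁))
  obtain ⟨k, hk, hkk₀, hk1⟩ := (hdev.and ((eventually_ge_atTop k₀).and
    (eventually_ge_atTop 1))).exists
  have hmd : 0 < m * d₁ := by positivity
  have hk0 : (0 : ℝ) < k := by exact_mod_cast hk1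
  have hCk : 4 * C ≤ m * d₁ * k := by
    have : (k₀ : ℝ) ≤ k := by exact_mod_cast hkk₀
    rw [div_le_iff₀' hmd] at hk₀
    exact hk₀.trans (mul_le_mul_of_nonneg_left this hmd.le)
  -- With `q = n / k` one has `n ≤ 2 k q`, so `V n ≤ m d₁ n / 4` uses half of `m d₁ k q`; the errors
  -- `C q + C ≤ 2 C q` use at most the other half. The term `k ^ β` makes the bound trivial for `n <
  -- k`.
  refine ⟨m * d₁ / 4, |d₂ k| * (2 * k) ^ β + (k : ℝ) ^ β, by positivity, by positivity, ?_⟩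
  intro n hn
  have hn0 : (0 : ℝ) < n := by exact_mod_cast hn
  have hnβ : 0 < (n : ℝ) ^ β := Real.rpow_pos_of_pos hn0 β
  by_cases hnk : n < k
  · refine (measureReal_le_one (μ := P)).trans ?_
    rw [le_div_iff₀ hnβ, one_mul]
    have h1 : (n : ℝ) ^ β ≤ (k : ℝ) ^ β :=
      Real.rpow_le_rpow hn0.le (by exact_mod_cast hnk.le) hβ.le
    have : 0 ≤ |d₂ k| * (2 * k : ℝ) ^ β := by positivity
    linarith
  · set q := n / k with hq
    have hkpos : 0 < k := hk1
    have hq1 : 1 ≤ q := (Nat.one_le_div_iff hkpos).2 (not_lt.1 hnk)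
    have hq0 : (1 : ℝ) ≤ q := by exact_mod_cast hq1
    have hdm : q * k + n % k = n := by rw [hq, mul_comm]; exact Nat.div_add_mod n k
    have hmod : n % k < k := Nat.mod_lt n hkpos
    have hn2 : (n : ℝ) ≤ 2 * k * q := by
      have : n ≤ 2 * k * q := by nlinarith
      exact_mod_cast this
    have hsub : P.real {ω | V n ω ≤ m * d₁ / 4 * n} ≤
        P.real {ω | ∑ j ∈ Finset.range q, W k (θ^[j * k] ω) ≤ d₁ * k * q} := by
      refine ENNReal.toReal_mono (measure_ne_top P _) (measure_mono_ae ?_)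
      filter_upwards [hadd, ae_forall_iterate hθ hVW] with ω h1 h2 hω
      have hω' : V n ω ≤ m * d₁ / 4 * n := hω
      have h3 := (abs_le.1 (h1.abs_sub_sum_le (hVz ω) k q)).1
      have h4 := (abs_le.1 (h1 (q * k) (n % k))).1
      rw [hdm] at h4
      have h5 := hV0 (n % k) (θ^[q * k] ω)
      have h6 : m * ∑ j ∈ Finset.range q, W k (θ^[j * k] ω) ≤
          ∑ j ∈ Finset.range q, V k (θ^[j * k] ω) := by
        rw [Finset.mul_sum]
        exact Finset.sum_le_sum fun j _ => h2 (j * k) k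
      have h7 : m * d₁ / 4 * n ≤ m * d₁ / 4 * (2 * k * q) :=
        mul_le_mul_of_nonneg_left hn2 (by positivity)
      have h8 : 4 * C * q ≤ m * d₁ * k * q := mul_le_mul_of_nonneg_right hCk (by linarith)
      have h9 : C ≤ C * q := le_mul_of_one_le_right hC hq0
      refine le_of_mul_le_mul_left ?_ hm
      linarith
    refine (hsub.trans (hk q hq1)).trans ?_
    have hqβ : 0 < (q : ℝ) ^ β := Real.rpow_pos_of_pos (by linarith) β
    rw [div_le_div_iff₀ hqβ hnβ]
    have h1 : (n : ℝ) ^ β ≤ (2 * k) ^ β * (q : ℝ) ^ β := by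
      rw [← Real.mul_rpow (by positivity) (by positivity)]
      exact Real.rpow_le_rpow hn0.le hn2 hβ.le
    have h2 : d₂ k * (n : ℝ) ^ β ≤ |d₂ k| * ((2 * k) ^ β * (q : ℝ) ^ β) :=
      mul_le_mul (le_abs_self _) h1 hnβ.le (abs_nonneg _)
    have h3 : 0 ≤ (k : ℝ) ^ β * (q : ℝ) ^ β := by positivity
    linarith

/-- Linear growth of the mean of a quasi-additive process with positive upper rate. -/
theorem exists_linear_growth_integral [IsProbabilityMeasure P] {θ : Ω → Ω}
    (hθ : MeasurePreserving θ P P) {V : ℕ → Ω → ℝ} {C : ℝ} {b : ℕ → ℝ} (hC : 0 ≤ C)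
    (hVm : ∀ n, Measurable (V n)) (hV0 : ∀ n ω, 0 ≤ V n ω) (hVz : ∀ ω, V 0 ω = 0)
    (hb : Monotone b) (hVb : ∀ᵐ ω ∂P, ∀ n, V n ω ≤ b n)
    (hadd : ∀ᵐ ω ∂P, QuasiAdditiveAt θ V C ω)
    (hpos : ∀ᵐ ω ∂P, 0 < asymptoticVariance V ω) :
    ∃ ε : ℝ, 0 < ε ∧ ∀ᶠ k : ℕ in atTop, ε * k ≤ ∫ ω, V k ω ∂P := by
  set R : ℕ → Set Ω := fun j => {ω | ∃ᶠ n : ℕ in atTop, 2 * (1 / ((j : ℝ) + 1)) * n < V n ω}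
    with hR
  have hRfull : ∀ᵐ ω ∂P, ω ∈ ⋃ j, R j := by
    filter_upwards [hpos] with ω hω
    obtain ⟨e, he0, he⟩ := ENNReal.lt_iff_exists_nnreal_btwn.1 hω
    have he0' : (0 : ℝ) < e := by exact_mod_cast he0
    obtain ⟨j, hj⟩ := exists_nat_one_div_lt (show (0 : ℝ) < e / 2 by positivity)
    refine Set.mem_iUnion.2 ⟨j, ?_⟩
    have h1 := (frequently_lt_of_lt_limsup (by isBoundedDefault) he).and_eventually
      (eventually_ge_atTop 1)
    refine h1.mono fun n hn => ?_
    obtain ⟨h2, h3⟩ := hn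
    have hn0 : (0 : ℝ) < n := by exact_mod_cast h3
    have h4 : (e : ℝ) < V n ω / n := by
      have := (ENNReal.ofReal_lt_ofReal_iff_of_nonneg e.2).1
        (by simpa [ENNReal.ofReal_coe_nnreal] using h2)
      exact this
    rw [lt_div_iff₀ hn0] at h4
    refine lt_of_le_of_lt (mul_le_mul_of_nonneg_right ?_ hn0.le) h4
    linarith
  obtain ⟨j, hj⟩ : ∃ j, P (R j) ≠ 0 := by
    by_contra hcon
    push Not at hcon
    have h1 : P (⋃ j, R j) = 0 := measure_iUnion_null hcon
    have h2 : ∀ᵐ ω ∂P, ω ∉ ⋃ j, R j := measure_eq_zero_iff_ae_notMem.1 h1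
    obtain ⟨ω, h3, h4⟩ := (hRfull.and h2).exists
    exact h4 h3
  set ε : ℝ := 1 / ((j : ℝ) + 1) with hε
  have hε0 : 0 < ε := by positivity
  have hPR : 0 < P.real (R j) := ENNReal.toReal_pos hj (measure_ne_top P _)
  refine ⟨ε / 2 * P.real (R j), by positivity, ?_⟩
  obtain ⟨k₀, hk₀⟩ := exists_nat_ge (2 * C / ε)
  filter_upwards [eventually_ge_atTop k₀, eventually_ge_atTop 1] with k hk hk1
  have hk0 : (0 : ℝ) < k := by exact_mod_cast hk1
  have hCk : 2 * C ≤ ε * k := by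
    have : (k₀ : ℝ) ≤ k := by exact_mod_cast hk
    rw [div_le_iff₀' hε0] at hk₀
    exact hk₀.trans (mul_le_mul_of_nonneg_left this hε0.le)
  have hint : Integrable (V k) P := by
    refine Integrable.of_bound (hVm k).aestronglyMeasurable (b k) ?_
    filter_upwards [hVb] with ω hω
    rw [Real.norm_eq_abs, abs_of_nonneg (hV0 k ω)]
    exact hω k
  -- On `R j`, `V n > 2 ε n` for arbitrarily large `n`. One `ε n` absorbs the incomplete block and
  -- its gluing error, bounded by `b k + C`; the other gives a block sum above `(ε k - C) q`. For `k
  -- ≥ 2 C / ε` the level `ε k - C` is at least `ε k / 2`.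
  have hmain := mul_measureReal_le_integral (hθ.iterate k) (hVm k) hint
    (Eventually.of_forall (hV0 k)) (a := ε * k - C) (by linarith) (R := R j) ?_
  · refine le_trans ?_ hmain
    have h1 : ε / 2 * k ≤ ε * k - C := by linarith
    have h2 := mul_le_mul_of_nonneg_right h1 hPR.le
    linarith
  · filter_upwards [hadd, ae_forall_iterate hθ hVb] with ω h1 h2 hω
    obtain ⟨L, hL⟩ := exists_nat_ge ((C + b k) / ε)
    have hω' : ∃ᶠ n : ℕ in atTop, 2 * ε * n < V n ω := hω
    obtain ⟨n, hn, hnL⟩ := (hω'.and_eventually (eventually_ge_atTop L)).exists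
    refine ⟨n / k, ?_⟩
    set q := n / k with hq
    have hdm : q * k + n % k = n := by rw [hq, mul_comm]; exact Nat.div_add_mod n k
    have hmod : n % k < k := Nat.mod_lt n hk1
    have h3 := (abs_le.1 (h1.abs_sub_sum_le (hVz ω) k q)).2
    have h4 := (abs_le.1 (h1 (q * k) (n % k))).2
    rw [hdm] at h4
    have h5 := (h2 (q * k) (n % k)).trans (hb hmod.le)
    have h6 : C + b k ≤ ε * n := by
      have : (L : ℝ) ≤ n := by exact_mod_cast hnL
      rw [div_le_iff₀' hε0] at hL
      exact hL.trans (mul_le_mul_of_nonneg_left this hε0.le)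
    have h7 : (q * k : ℝ) ≤ n := by
      have : q * k ≤ n := by omega
      exact_mod_cast this
    have h8 : birkhoffSum θ^[k] (fun ω => V k ω - (ε * k - C)) q ω =
        ∑ j ∈ Finset.range q, V k (θ^[j * k] ω) - (ε * k - C) * q := by
      simp only [birkhoffSum, Finset.sum_sub_distrib, ← Function.iterate_mul, mul_comm k,
        Finset.sum_const, Finset.card_range, nsmul_eq_mul]
      ring
    rw [h8]
    have h9 := mul_le_mul_of_nonneg_left h7 hε0.le
    linarith

/-- Concentration of block variances whose means grow linearly gives a lower deviation bound. -/
theorem BlockConcentration.blockLowerDeviation [IsFiniteMeasure P] {θ : Ω → Ω}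
    {W : ℕ → Ω → ℝ} {β ε : ℝ} (hε : 0 < ε) (hgrowth : ∀ᶠ k : ℕ in atTop, ε * k ≤ ∫ ω, W k ω ∂P)
    (hW : BlockConcentration P θ W β) : BlockLowerDeviation P θ W β := by
  obtain ⟨d, hd⟩ := hW
  -- The allowed deviation is `ε k / 2`, at most half of the mean of the block variance, so it may
  -- depend on `k`.
  refine ⟨ε / 2, fun k => d k (ε / 2 * k), by positivity, ?_⟩
  filter_upwards [hd, hgrowth, eventually_ge_atTop 1] with k h1 h2 hk n hn
  have hk0 : (0 : ℝ) < k := by exact_mod_cast hk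
  refine le_trans (measureReal_mono ?_) (h1 (ε / 2 * k) (by positivity) n hn)
  intro ω hω
  have hω' : ∑ j ∈ Finset.range n, W k (θ^[j * k] ω) ≤ ε / 2 * k * n := hω
  have h3 := mul_le_mul_of_nonneg_right h2 (Nat.cast_nonneg (α := ℝ) n)
  change ε / 2 * k * n ≤ |_|
  refine le_trans ?_ (neg_le_abs _)
  linarith

end Deviations

/-! ### Measurability in the random parameter -/

section Measurability

variable {Ω X : Type*} [MeasurableSpace Ω] [MeasurableSpace X]

theorem measurable_fiberIter {θ : Ω → Ω} (hθ : Measurable θ) {T : Ω → X → X}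
    (hT : Measurable (fun q : Ω × X => T q.1 q.2)) (n : ℕ) :
    Measurable (fun q : Ω × X => fiberIter θ T n q.1 q.2) := by
  induction n with
  | zero => exact measurable_snd
  | succ n ih => exact hT.comp (((hθ.iterate n).comp measurable_fst).prodMk ih)

theorem measurable_fiberSum {θ : Ω → Ω} (hθ : Measurable θ) {T : Ω → X → X}
    (hT : Measurable (fun q : Ω × X => T q.1 q.2)) {ψ : Ω → X → ℝ}
    (hψ : Measurable (fun q : Ω × X => ψ q.1 q.2)) (n : ℕ) :
    Measurable (fun q : Ω × X => fiberSum θ T ψ n q.1 q.2) := by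
  unfold fiberSum
  exact Finset.measurable_sum _ fun j _ =>
    hψ.comp (((hθ.iterate j).comp measurable_fst).prodMk (measurable_fiberIter hθ hT j))

/-- The Gibbs measures form a kernel, namely `ν` with density `h`, so integrals against them are
measurable in `ω`. -/
theorem measurable_integral_gibbs {h : Ω → X → ℝ} {ν : Kernel Ω X} [IsSFiniteKernel ν]
    (hh : Measurable (fun q : Ω × X => h q.1 q.2)) {f : Ω → X → ℝ}
    (hf : Measurable (fun q : Ω × X => f q.1 q.2)) :
    Measurable (fun ω => ∫ x, f ω x ∂(gibbs h ν ω)) := by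
  have h1 : Measurable (Function.uncurry fun ω x => ENNReal.ofReal (h ω x)) := hh.ennreal_ofReal
  have h2 : ∀ ω, gibbs h ν ω = ν.withDensity (fun ω x => ENNReal.ofReal (h ω x)) ω := fun ω => by
    rw [Kernel.withDensity_apply _ h1]; rfl
  have : IsSFiniteKernel (ν.withDensity fun ω x => ENNReal.ofReal (h ω x)) :=
    Kernel.IsSFiniteKernel.withDensity ν fun _ _ => ENNReal.ofReal_ne_top
  simp only [h2]
  exact (StronglyMeasurable.integral_kernel_prod_right
    (κ := ν.withDensity fun ω x => ENNReal.ofReal (h ω x)) (f := f)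
    hf.stronglyMeasurable).measurable

theorem measurable_centered {h : Ω → X → ℝ} {ν : Kernel Ω X} [IsSFiniteKernel ν]
    (hh : Measurable (fun q : Ω × X => h q.1 q.2)) {u : Ω → X → ℝ}
    (hu : Measurable (fun q : Ω × X => u q.1 q.2)) :
    Measurable (fun q : Ω × X => centered (gibbs h ν) u q.1 q.2) :=
  hu.sub ((measurable_integral_gibbs hh hu).comp measurable_fst)

theorem measurable_fiberVariance {θ : Ω → Ω} (hθ : Measurable θ) {T : Ω → X → X}
    (hT : Measurable (fun q : Ω × X => T q.1 q.2)) {h : Ω → X → ℝ} {ν : Kernel Ω X}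
    [IsSFiniteKernel ν] (hh : Measurable (fun q : Ω × X => h q.1 q.2)) {u : Ω → X → ℝ}
    (hu : Measurable (fun q : Ω × X => u q.1 q.2)) (n : ℕ) :
    Measurable (fiberVariance θ T u (gibbs h ν) n) := by
  have hS := measurable_fiberSum hθ hT hu n
  have h1 : fiberVariance θ T u (gibbs h ν) n = fun ω =>
      ∫ x, (fiberSum θ T u n ω x - ∫ y, fiberSum θ T u n ω y ∂(gibbs h ν ω)) ^ 2
        ∂(gibbs h ν ω) := by
    funext ω
    exact variance_eq_integral (hS.comp measurable_prodMk_left).aemeasurable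
  rw [h1]
  exact measurable_integral_gibbs hh
    ((hS.sub ((measurable_integral_gibbs hh hS).comp measurable_fst)).pow_const 2)

theorem measurable_blockVariance {θ : Ω → Ω} (hθ : Measurable θ) {T : Ω → X → X}
    (hT : Measurable (fun q : Ω × X => T q.1 q.2)) {h : Ω → X → ℝ} {ν : Kernel Ω X}
    [IsSFiniteKernel ν] (hh : Measurable (fun q : Ω × X => h q.1 q.2)) {u : Ω → X → ℝ}
    (hu : Measurable (fun q : Ω × X => u q.1 q.2)) (κ : Measure X) [SFinite κ] (n : ℕ) :
    Measurable (blockVariance θ T u (gibbs h ν) κ n) :=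
  (((measurable_fiberSum hθ hT (measurable_centered hh hu) n).pow_const
    2).stronglyMeasurable.integral_prod_right (ν := κ)).measurable

end Measurability

/-! ### Comparison with the reference measure, and centering -/

section Comparison

variable {X : Type*} [MeasurableSpace X]

/-- Finiteness of the reference measure is not assumed; it follows from a density bounded below
whose total mass is finite. -/
theorem isFiniteMeasure_of_withDensity {κ : Measure X} {r : X → ℝ} {m : ℝ} (hm : 0 < m)
    (hr : ∀ x, m ≤ r x) [IsFiniteMeasure (κ.withDensity fun x => ENNReal.ofReal (r x))] :
    IsFiniteMeasure κ := by
  constructor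
  have h1 : ENNReal.ofReal m * κ Set.univ ≤
      (κ.withDensity fun x => ENNReal.ofReal (r x)) Set.univ := by
    rw [withDensity_apply _ MeasurableSet.univ, Measure.restrict_univ, ← lintegral_const]
    exact lintegral_mono fun x => ENNReal.ofReal_le_ofReal (hr x)
  have h2 := h1.trans_lt (measure_lt_top _ _)
  refine lt_of_not_ge fun h3 => ?_
  rw [top_le_iff.1 h3, ENNReal.mul_top (by simpa using hm)] at h2
  exact lt_irrefl _ h2

theorem integral_withDensity_mem_Icc {κ : Measure X} {r f : X → ℝ} {m M : ℝ} (hm : 0 < m)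
    (hrm : Measurable r) (hr : ∀ x, r x ∈ Set.Ioo m M) (hf : Integrable f κ)
    (hf0 : ∀ x, 0 ≤ f x) :
    ∫ x, f x ∂(κ.withDensity fun x => ENNReal.ofReal (r x)) ∈
      Set.Icc (m * ∫ x, f x ∂κ) (M * ∫ x, f x ∂κ) := by
  rw [integral_withDensity_ofReal hrm (fun x => hm.le.trans (hr x).1.le)]
  have hfr : Integrable (fun x => f x * r x) κ := by
    refine hf.mul_bdd (c := M) hrm.aestronglyMeasurable (Eventually.of_forall fun x => ?_)
    rw [Real.norm_eq_abs, abs_of_pos (hm.trans (hr x).1)]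
    exact (hr x).2.le
  constructor
  · rw [← integral_const_mul]
    refine integral_mono (hf.const_mul m) hfr fun x => ?_
    have := mul_le_mul_of_nonneg_left (hr x).1.le (hf0 x)
    simpa [mul_comm] using this
  · rw [← integral_const_mul]
    refine integral_mono hfr (hf.const_mul M) fun x => ?_
    have := mul_le_mul_of_nonneg_left (hr x).2.le (hf0 x)
    simpa [mul_comm] using this

end Comparison

section Centering

variable {Ω X : Type*} [MeasurableSpace X] {μ : Ω → Measure X} {u : Ω → X → ℝ} {U : ℝ} {ω : Ω}

theorem abs_centered_le [IsProbabilityMeasure (μ ω)] (hu : ∀ x, |u ω x| ≤ U) (x : X) :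
    |centered μ u ω x| ≤ 2 * U := by
  have h1 := abs_integral_le_of_abs_le (μ := μ ω) hu
  unfold centered
  refine (abs_sub _ _).trans ?_
  linarith [hu x]

theorem integral_centered [IsProbabilityMeasure (μ ω)] (hu : Integrable (u ω) (μ ω)) :
    ∫ x, centered μ u ω x ∂(μ ω) = 0 := by
  unfold centered
  rw [integral_sub hu (integrable_const _)]
  simp

end Centering

/-! ### Assembly -/

section Main

variable {Ω X : Type*} [MeasurableSpace Ω] {P : Measure Ω} [IsProbabilityMeasure P]
  [MetricSpace X] [CompactSpace X] [Nonempty X] [MeasurableSpace X] [BorelSpace X]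

/-- The fiber variances with respect to the Gibbs measures are quasi-additive, bounded on each
block length, and equal to the second moments of the centered fiber sums. -/
theorem StandingAssumptions.exists_variance_structure {θ : Ω ≃ᵐ Ω}
    (hθ : MeasurePreserving θ P P) {T : Ω → X → X} {φ u : Ω → X → ℝ} {α ξ : ℝ}
    (hT : StandingAssumptions P θ T φ u α ξ) {lam : Ω → ℝ} {h : Ω → X → ℝ} {ν : Kernel Ω X}
    (hRPF : IsRPFTriplet P θ T φ α ξ lam h ν) :
    ∃ C U : ℝ, 0 ≤ C ∧ 0 ≤ U ∧ ∀ᵐ ω ∂P, IsProbabilityMeasure (gibbs h ν ω) ∧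
      QuasiAdditiveAt θ (fiberVariance θ T u (gibbs h ν)) C ω ∧
      (∀ n, Continuous (fiberSum θ T (centered (gibbs h ν) u) n ω)) ∧
      (∀ n x, |fiberSum θ T (centered (gibbs h ν) u) n ω x| ≤ n * U) ∧
      ∀ n, fiberVariance θ T u (gibbs h ν) n ω =
        ∫ x, fiberSum θ T (centered (gibbs h ν) u) n ω x ^ 2 ∂(gibbs h ν ω) := by
  have hα := hT.alpha_pos
  have hξ := hT.xi_pos
  have := hRPF.isMarkov
  obtain ⟨c, D, H, U, Q, K, N, hc0, hc1, hD, hH, hU, hQ, hK, hN, hreg⟩ :=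
    hT.exists_regularFiber hθ hRPF
  set good : Set Ω := {ω | ∀ n, RegularFiber θ T φ u h lam ν α ξ c D H U Q K N (θ^[n] ω)}
    with hgood
  have h0 : ∀ ω ∈ good, RegularFiber θ T φ u h lam ν α ξ c D H U Q K N ω := fun ω hω => hω 0
  have hprob : ∀ ω ∈ good, IsProbabilityMeasure (gibbs h ν ω) := fun ω hω =>
    (h0 ω hω).isProbabilityMeasure_gibbs hα hξ
  have hA : DualContraction θ T (normalizedOp θ T φ h lam) (gibbs h ν) good α ξ (c ^ α)
      (H + Q + Q / c ^ α) ((D * Real.exp H * K * Real.exp H)⁻¹) N :=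
    { uniformlyContracting_normalizedOp hα hξ hc0 hc1 hD hH hQ hK hN with
      continuous_map := hT.continuous_map
      isProbabilityMeasure := hprob
      dual := fun ω hω F g hF hg =>
        (h0 ω hω).integral_mul_comp (hω 1) hα hξ (hT.continuous_map ω) hF hg }
  have huc : ∀ ω ∈ good, Continuous (u ω) := fun ω hω =>
    continuous_of_locally_holder hα hξ (h0 ω hω).observable_holder
  have hcU : ∀ ω ∈ good, ∀ x, |centered (gibbs h ν) u ω x| ≤ 2 * U := fun ω hω => by
    have := hprob ω hω
    exact abs_centered_le (h0 ω hω).observable_le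
  have hcH : ∀ ω ∈ good, ∀ x x', dist x x' < ξ →
      |centered (gibbs h ν) u ω x - centered (gibbs h ν) u ω x'| ≤ 2 * U * dist x x' ^ α := by
    intro ω hω x x' hx
    have h1 := (h0 ω hω).observable_holder x x' hx
    have h2 : 0 ≤ U * dist x x' ^ α := by positivity
    unfold centered
    rw [sub_sub_sub_cancel_right]
    linarith
  have hc0 : ∀ ω ∈ good, ∫ x, centered (gibbs h ν) u ω x ∂(gibbs h ν ω) = 0 := fun ω hω => by
    have := hprob ω hω
    exact integral_centered (integrable_of_continuous (huc ω hω))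
  obtain ⟨C, hC, hquasi⟩ := hA.exists_quasi_additive (by positivity) hcU hcH hc0
  refine ⟨C, 2 * U, hC, by positivity, ?_⟩
  filter_upwards [hreg] with ω hω
  have hω' : ω ∈ good := hω
  refine ⟨hprob ω hω', fun a b => ?_, fun n => hA.continuous_fiberSum (fun ω hω =>
    (huc ω hω).sub continuous_const) hω' n,
    abs_fiberSum_le fun n => hcU _ (hA.shift_iterate hω' n),
    fun n => hA.fiberVariance_eq huc hω' n⟩
  rw [hA.fiberVariance_eq huc hω', hA.fiberVariance_eq huc hω',
    hA.fiberVariance_eq huc (hA.shift_iterate hω' a)]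
  exact hquasi ω hω' a b

end Main

end RandomExpanding

theorem mainTheorem8 {Ω X : Type*} [MeasurableSpace Ω] (P : Measure Ω) [IsProbabilityMeasure P]
    [P.IsComplete] [MetricSpace X] [CompactSpace X] [MeasurableSpace X] [BorelSpace X]
    (θ : Ω ≃ᵐ Ω) (hθ : Ergodic θ P)
    (T : Ω → X → X) (φ u : Ω → X → ℝ) (α ξ : ℝ)
    (hT : RandomExpanding.StandingAssumptions P θ T φ u α ξ)
    (lam : Ω → ℝ) (h : Ω → X → ℝ) (ν : Kernel Ω X)
    (hRPF : RandomExpanding.IsRPFTriplet P θ T φ α ξ lam h ν)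
    (κ : Measure X) (r : Ω → X → ℝ) (m M : ℝ) (hm : 0 < m)
    (hr_meas : ∀ᵐ ω ∂P, Measurable (r ω))
    (hr_mem : ∀ᵐ ω ∂P, ∀ x, r ω x ∈ Set.Ioo m M)
    (hr : ∀ᵐ ω ∂P,
      RandomExpanding.gibbs h ν ω = κ.withDensity (fun x => ENNReal.ofReal (r ω x)))
    (β : ℝ) (hβ : 0 < β) :
    (RandomExpanding.BlockLowerDeviation P θ
        (RandomExpanding.blockVariance θ T u (RandomExpanding.gibbs h ν) κ) β →
      RandomExpanding.VarianceGrowth P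
        (RandomExpanding.fiberVariance θ T u (RandomExpanding.gibbs h ν)) β) ∧
    ((∀ᵐ ω ∂P, 0 < RandomExpanding.asymptoticVariance
        (RandomExpanding.fiberVariance θ T u (RandomExpanding.gibbs h ν)) ω) →
      RandomExpanding.BlockConcentration P θ
        (RandomExpanding.blockVariance θ T u (RandomExpanding.gibbs h ν) κ) β →
      RandomExpanding.VarianceGrowth P
        (RandomExpanding.fiberVariance θ T u (RandomExpanding.gibbs h ν)) β) := by
  have hmp : MeasurePreserving θ P P := hθ.toMeasurePreserving
  have := hRPF.isMarkov
  have hX : Nonempty X := by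
    obtain ⟨ω⟩ : Nonempty Ω := P.nonempty_of_neZero
    exact (ν ω).nonempty_of_neZero
  obtain ⟨C, U, hC, hU, hV⟩ := hT.exists_variance_structure hmp hRPF
  set V := RandomExpanding.fiberVariance θ T u (RandomExpanding.gibbs h ν) with hVdef
  set W := RandomExpanding.blockVariance θ T u (RandomExpanding.gibbs h ν) κ with hWdef
  -- Neither fact involves `ω`, so a single good `ω` suffices.
  obtain ⟨hκ, hM⟩ : IsFiniteMeasure κ ∧ 0 < M := by
    obtain ⟨ω, ⟨h1, -⟩, h2, h3⟩ := (hV.and (hr_mem.and hr)).exists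
    rw [h3] at h1
    obtain ⟨x⟩ := hX
    exact ⟨RandomExpanding.isFiniteMeasure_of_withDensity hm fun x => (h2 x).1.le,
      hm.trans ((h2 x).1.trans (h2 x).2)⟩
  have hV0 : ∀ n ω, 0 ≤ V n ω := fun n ω => variance_nonneg _ _
  have hVz : ∀ ω, V 0 ω = 0 := fun ω => variance_zero _
  have hquasi : ∀ᵐ ω ∂P, RandomExpanding.QuasiAdditiveAt θ V C ω := by
    filter_upwards [hV] with ω hω using hω.2.1
  have hVW : ∀ᵐ ω ∂P, ∀ k, V k ω ∈ Set.Icc (m * W k ω) (M * W k ω) := by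
    filter_upwards [hV, hr_meas, hr_mem, hr] with ω ⟨_, _, hcont, _, hVeq⟩ h2 h3 h4 k
    rw [hVeq k, h4]
    exact RandomExpanding.integral_withDensity_mem_Icc hm h2 h3
      (RandomExpanding.integrable_of_continuous ((hcont k).pow 2)) (fun x => sq_nonneg _)
  have hpart : RandomExpanding.BlockLowerDeviation P θ W β →
      RandomExpanding.VarianceGrowth P V β := fun hW =>
    hW.varianceGrowth hmp hβ hC hm hV0 hVz hquasi
      (hVW.mono fun ω hω k => (hω k).1)
  refine ⟨hpart, fun hpos hconc => hpart ?_⟩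
  have hb : Monotone fun n : ℕ => ((n : ℝ) * U) ^ 2 := fun a b hab => by
    have : (a : ℝ) ≤ b := by exact_mod_cast hab
    simp only
    gcongr
  have hVb : ∀ᵐ ω ∂P, ∀ n : ℕ, V n ω ≤ ((n : ℝ) * U) ^ 2 := by
    filter_upwards [hV] with ω ⟨h1, _, _, hle, hVeq⟩ n
    rw [hVeq n]
    refine (le_abs_self _).trans (RandomExpanding.abs_integral_le_of_abs_le fun x => ?_)
    rw [abs_pow]
    exact pow_le_pow_left₀ (abs_nonneg _) (hle n x) 2
  obtain ⟨ε, hε, hgrow⟩ := RandomExpanding.exists_linear_growth_integral hmp hC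
    (RandomExpanding.measurable_fiberVariance θ.measurable hT.measurable_map
      hRPF.measurable_eigenfunction hT.measurable_observable) hV0 hVz hb hVb hquasi hpos
  -- Since `V_k ≤ M Ṽ_k`, the growth rate `ε` of the mean of `V_k` becomes `ε / M` for `Ṽ_k`.
  refine hconc.blockLowerDeviation (ε := ε / M) (by positivity) ?_
  filter_upwards [hgrow] with k hk
  have hWm : Measurable (W k) := RandomExpanding.measurable_blockVariance θ.measurable
    hT.measurable_map hRPF.measurable_eigenfunction hT.measurable_observable κ k
  have hWi : Integrable (W k) P := by
    refine Integrable.of_bound hWm.aestronglyMeasurable (((k : ℝ) * U) ^ 2 / m) ?_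
    filter_upwards [hVW, hVb] with ω h1 h2
    have h3 : 0 ≤ W k ω := integral_nonneg fun x => sq_nonneg _
    rw [Real.norm_eq_abs, abs_of_nonneg h3, le_div_iff₀' hm]
    exact (h1 k).1.trans (h2 k)
  have h1 : ∫ ω, V k ω ∂P ≤ M * ∫ ω, W k ω ∂P := by
    rw [← integral_const_mul]
    refine integral_mono_of_nonneg (Eventually.of_forall (hV0 k)) (hWi.const_mul M) ?_
    filter_upwards [hVW] with ω hω using (hω k).2
  have h2 : ε * k ≤ M * ∫ ω, W k ω ∂P := hk.trans h1
  rw [div_mul_eq_mul_div, div_le_iff₀' hM]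
  exact h2
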